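/- Let $m_1,m_2\ge 1$, $m=m_1+m_2$ and $j=\mathrm{diag}(I_{m_1},-I_{m_2})$. Let $n\ge 1$, let $A$ and $S_0$ be $n\times n$ complex matrices and $\Pi_0$ an $n\times m$ complex matrix such that $$S_0>0,\qquad AS_0-S_0A^*=\mathrm{i}\,\Pi_0 j\Pi_0^*,\qquad \sigma(A)\subset\mathbb C_+=\{\operatorname{Im}\lambda>0\},\qquad \mathrm{i}\notin\sigma(A)$$ (so that $\det A\neq 0$). For $k\ge 0$ put $$\Pi_{k+1}=\Pi_k+\mathrm{i}A^{-1}\Pi_k j,\qquad S_{k+1}=S_k+A^{-1}S_k(A^*)^{-1}+A^{-1}\Pi_k\Pi_k^*(A^*)^{-1},$$ $$C_k=I_m+\Pi_k^*S_k^{-1}\Pi_k-\Pi_{k+1}^*S_{k+1}^{-1}\Pi_{k+1}$$ (such a sequence $\{C_k\}$ is called a strictly pseudo-exponential potential). Consider the discrete Dirac system $$y_{k+1}(z)=(I_m+\mathrm{i}zjC_k)\,y_k(z)\qquad(k=0,1,2,\dots),$$ and let $W_k(z)$ be its fundamental solution with $W_0(z)=I_m$. Then $C_k>0$ and $C_kjC_k=j$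 for all $k$, and the following hold. 1. For every $z\in\mathbb R$ there is a unique $m\times m$ matrix solution $\{F_k(z)\}$ of the system (the Jost solution) such that $F_k(z)=(I_m+\mathrm{i}zj)^k(I_m+o(1))$ as $k\to\infty$. The lower right $m_2\times m_2$ block of $F_0(z)$ is invertible, so that the reflection coefficient $$\mathcal R(z)=\begin{bmatrix}I_{m_1}&0\end{bmatrix}F_0(z)\begin{bmatrix}0\\ I_{m_2}\end{bmatrix}\left(\begin{bmatrix}0&I_{m_2}\end{bmatrix}F_0(z)\begin{bmatrix}0\\ I_{m_2}\end{bmatrix}\right)^{-1}\qquad(z\in\mathbb R)$$ is well defined. 2. There is a unique $m_1\times m_2$ matrix function $\varphi$ on $\mathbb C_-=\{\operatorname{Im}z<0\}$ (the Weyl function) such that $$\sum_{k=0}^\infty(1+|z|^2)^{-k}\begin{bmatrix}\varphi(z)^*&I_{m_2}\end{bmatrix}W_k(z)^*C_kW_k(z)\begin{bmatrix}\varphi(z)\\ I_{m_2}\end{bmatrix}<\infty\qquad(z\in\mathbb C_-).$$ 3. There is a rational $m_1\times m_2$ matrix function $r$ without poles in $\mathbb R\cup\mathbb C_-$ such that $\mathcal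 R(z)=r(z)$ for all $z\in\mathbb R$ and $\varphi(z)=r(z)$ for all $z\in\mathbb C_-$. 4. $\varphi$ is the unique analytic continuation of $\mathcal R$: some function analytic on a connected open set containing $\mathbb R\cup\mathbb C_-$ equals $\mathcal R$ on $\mathbb R$ and $\varphi$ on $\mathbb C_-$; and if $U\subset\mathbb C$ is open and connected with $U\cap\mathbb R\ne\emptyset$, and $\Psi$ is an analytic $m_1\times m_2$ matrix function on $U$ with $\Psi=\mathcal R$ on $U\cap\mathbb R$, then $\Psi=\varphi$ on $U\cap\mathbb C_-$. -/

import Mathlib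

open Matrix Filter Topology
open scoped ComplexOrder

namespace DiscreteDirac

noncomputable section

/-- Square matrices of order `m = m₁ + m₂`, with rows and columns split into blocks of sizes
`m₁` and `m₂`. -/
abbrev BlockMat (m₁ m₂ : ℕ) : Type := Matrix (Fin m₁ ⊕ Fin m₂) (Fin m₁ ⊕ Fin m₂) ℂ

/-- The signature matrix `j = diag(I_{m₁}, -I_{m₂})`. -/
def sig (m₁ m₂ : ℕ) : BlockMat m₁ m₂ := fromBlocks 1 0 0 (-1)

/-- The matrices `C_k` are positive definite and `j`-unitary. -/
def IsDiracPotential {m₁ m₂ : ℕ} (C : ℕ → BlockMat m₁ m₂) : Prop :=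
  ∀ k, (C k).PosDef ∧ C k * sig m₁ m₂ * C k = sig m₁ m₂

/-- `y` is an `m × m` matrix solution, at the point `z`, of the self-adjoint discrete Dirac system
`y_{k+1} = (I_m + i z j C_k) y_k`. -/
def IsSolution {m₁ m₂ : ℕ} (C : ℕ → BlockMat m₁ m₂) (z : ℂ) (y : ℕ → BlockMat m₁ m₂) : Prop :=
  ∀ k, y (k + 1) = (1 + (Complex.I * z) • (sig m₁ m₂ * C k)) * y k

/-- The fundamental solution `W_k(z)`, normalized by `W_0(z) = I_m`. -/
def fundSol {m₁ m₂ : ℕ} (C : ℕ → BlockMat m₁ m₂) (z : ℂ) : ℕ → BlockMat m₁ m₂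
  | 0 => 1
  | k + 1 => (1 + (Complex.I * z) • (sig m₁ m₂ * C k)) * fundSol C z k

theorem fundSol_isSolution {m₁ m₂ : ℕ} (C : ℕ → BlockMat m₁ m₂) (z : ℂ) :
    IsSolution C z (fundSol C z) := fun _ => rfl

/-! ### Jost solution and reflection coefficient -/

/-- `F` is a Jost solution at the real point `z`: a matrix solution of the system with
`F_k = (I_m + i z j)^k (I_m + o(1))` as `k → ∞`. -/
def IsJostSolution {m₁ m₂ : ℕ} (C : ℕ → BlockMat m₁ m₂) (z : ℝ) (F : ℕ → BlockMat m₁ m₂) : Prop :=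
  IsSolution C (z : ℂ) F ∧
    ∃ E : ℕ → BlockMat m₁ m₂, Tendsto E atTop (𝓝 0) ∧
      ∀ k, F k = (1 + (Complex.I * (z : ℂ)) • sig m₁ m₂) ^ k * (1 + E k)

/-- `R` is the reflection coefficient on the real axis: at every real `z` there is a Jost solution
`F` whose initial value `F_0` has an invertible lower right block, and `R(z)` is the upper right
block of `F_0` times the inverse of the lower right block. -/
def IsReflectionCoefficient {m₁ m₂ : ℕ} (C : ℕ → BlockMat m₁ m₂)
    (R : ℝ → Matrix (Fin m₁) (Fin m₂) ℂ) : Prop :=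
  ∀ z : ℝ, ∃ F : ℕ → BlockMat m₁ m₂, IsJostSolution C z F ∧ IsUnit (F 0).toBlocks₂₂ ∧
    R z = (F 0).toBlocks₁₂ * ((F 0).toBlocks₂₂)⁻¹

/-! ### Weyl function -/

/-- The column `[φ; I_{m₂}]`. -/
def weylCol {m₁ m₂ : ℕ} (φ : Matrix (Fin m₁) (Fin m₂) ℂ) :
    Matrix (Fin m₁ ⊕ Fin m₂) (Fin m₂) ℂ := fromRows φ 1

/-- `φ` is a Weyl function in the open lower half-plane: the series
`∑ q(z)^k [φ(z)^* I] W_k(z)^* C_k W_k(z) [φ(z); I]`, with `q(z) = (1 + |z|^2)⁻¹`, converges for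
every `z` with `Im z < 0`. Values of `φ` elsewhere are irrelevant. -/
def IsWeylFunction {m₁ m₂ : ℕ} (C : ℕ → BlockMat m₁ m₂)
    (φ : ℂ → Matrix (Fin m₁) (Fin m₂) ℂ) : Prop :=
  ∀ z : ℂ, z.im < 0 → Summable fun k : ℕ =>
    (((1 + ‖z‖ ^ 2)⁻¹ : ℝ) : ℂ) ^ k •
      ((weylCol (φ z))ᴴ * (fundSol C z k)ᴴ * C k * fundSol C z k * weylCol (φ z))

/-! ### Potentials determined by triples of parameter matrices -/

/-- The sequence `Π_{k+1} = Π_k + i A⁻¹ Π_k j`. -/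
def piSeq {n m₁ m₂ : ℕ} (A : Matrix (Fin n) (Fin n) ℂ) (P₀ : Matrix (Fin n) (Fin m₁ ⊕ Fin m₂) ℂ) :
    ℕ → Matrix (Fin n) (Fin m₁ ⊕ Fin m₂) ℂ
  | 0 => P₀
  | k + 1 => piSeq A P₀ k + Complex.I • (A⁻¹ * piSeq A P₀ k * sig m₁ m₂)

/-- The sequence `S_{k+1} = S_k + A⁻¹ S_k (A^*)⁻¹ + A⁻¹ Π_k Π_k^* (A^*)⁻¹`. -/
def sSeq {n m₁ m₂ : ℕ} (A S₀ : Matrix (Fin n) (Fin n) ℂ)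
    (P₀ : Matrix (Fin n) (Fin m₁ ⊕ Fin m₂) ℂ) : ℕ → Matrix (Fin n) (Fin n) ℂ
  | 0 => S₀
  | k + 1 => sSeq A S₀ P₀ k + A⁻¹ * sSeq A S₀ P₀ k * (Aᴴ)⁻¹ +
      A⁻¹ * (piSeq A P₀ k * (piSeq A P₀ k)ᴴ) * (Aᴴ)⁻¹

/-- The potential `C_k = I_m + Π_k^* S_k⁻¹ Π_k - Π_{k+1}^* S_{k+1}⁻¹ Π_{k+1}` determined by the
triple `{A, S₀, Π₀}`. -/
def potential {n m₁ m₂ : ℕ} (A S₀ : Matrix (Fin n) (Fin n) ℂ)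
    (P₀ : Matrix (Fin n) (Fin m₁ ⊕ Fin m₂) ℂ) (k : ℕ) : BlockMat m₁ m₂ :=
  1 + (piSeq A P₀ k)ᴴ * (sSeq A S₀ P₀ k)⁻¹ * piSeq A P₀ k -
    (piSeq A P₀ (k + 1))ᴴ * (sSeq A S₀ P₀ (k + 1))⁻¹ * piSeq A P₀ (k + 1)

/-- Admissible triples `{A, S₀, Π₀}`: `det A ≠ 0`, `S₀ > 0` and `A S₀ - S₀ A^* = i Π₀ j Π₀^*`. -/
structure IsAdmissible {n m₁ m₂ : ℕ} (A S₀ : Matrix (Fin n) (Fin n) ℂ)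
    (P₀ : Matrix (Fin n) (Fin m₁ ⊕ Fin m₂) ℂ) : Prop where
  det_ne_zero : A.det ≠ 0
  posDef : S₀.PosDef
  identity : A * S₀ - S₀ * Aᴴ = Complex.I • (P₀ * sig m₁ m₂ * P₀ᴴ)

/-- Strongly admissible triples: admissible, with the spectrum of `A` in the open upper half-plane
and not containing `i`. -/
structure IsStronglyAdmissible {n m₁ m₂ : ℕ} (A S₀ : Matrix (Fin n) (Fin n) ℂ)
    (P₀ : Matrix (Fin n) (Fin m₁ ⊕ Fin m₂) ℂ) : Prop extends IsAdmissible A S₀ P₀ where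
  spectrum_upper : ∀ μ ∈ spectrum ℂ A, 0 < μ.im
  i_notMem : Complex.I ∉ spectrum ℂ A

/-- Strictly pseudo-exponential potentials: those determined by a strongly admissible triple. -/
def IsStrictlyPseudoExponential {m₁ m₂ : ℕ} (C : ℕ → BlockMat m₁ m₂) : Prop :=
  ∃ (n : ℕ) (_ : 0 < n) (A S₀ : Matrix (Fin n) (Fin n) ℂ)
    (P₀ : Matrix (Fin n) (Fin m₁ ⊕ Fin m₂) ℂ),
    IsStronglyAdmissible A S₀ P₀ ∧ ∀ k, C k = potential A S₀ P₀ k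

/-! ### Rational matrix functions and analytic continuation -/

/-- `r` has no pole at `z`: no denominator (in lowest terms) of an entry vanishes at `z`. -/
def RegularAt {m₁ m₂ : ℕ} (r : Matrix (Fin m₁) (Fin m₂) (RatFunc ℂ)) (z : ℂ) : Prop :=
  ∀ a b, (r a b).denom.eval z ≠ 0

/-- The value at `z` of a rational matrix function (meaningful where it is regular). -/
def ratEval {m₁ m₂ : ℕ} (r : Matrix (Fin m₁) (Fin m₂) (RatFunc ℂ)) (z : ℂ) :
    Matrix (Fin m₁) (Fin m₂) ℂ :=
  Matrix.of fun a b => (r a b).eval (RingHom.id ℂ) z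

/-- Analyticity of a matrix function on an open set `U`, entry by entry. -/
def AnalyticMat {m₁ m₂ : ℕ} (Ψ : ℂ → Matrix (Fin m₁) (Fin m₂) ℂ) (U : Set ℂ) : Prop :=
  ∀ a b, AnalyticOnNhd ℂ (fun z => Ψ z a b) U

/-- `φ`, on the open lower half-plane, is the unique analytic continuation of `R`, given on the
real axis: some function analytic on a connected open neighbourhood of the closed lower half-plane
agrees with `R` on the real axis and with `φ` below it, and every function that is analytic on
some connected open set meeting the real axis and that agrees with `R` on the real points of this
set agrees with `φ` on the part of the set in the lower half-plane. -/
structure IsUniqueAnalyticContinuation {m₁ m₂ : ℕ} (R : ℝ → Matrix (Fin m₁) (Fin m₂) ℂ)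
    (φ : ℂ → Matrix (Fin m₁) (Fin m₂) ℂ) : Prop where
  exists_continuation : ∃ (U : Set ℂ) (Ψ : ℂ → Matrix (Fin m₁) (Fin m₂) ℂ),
    IsOpen U ∧ IsConnected U ∧ {z : ℂ | z.im ≤ 0} ⊆ U ∧ AnalyticMat Ψ U ∧
      (∀ x : ℝ, Ψ (x : ℂ) = R x) ∧ ∀ z : ℂ, z.im < 0 → Ψ z = φ z
  unique : ∀ (U : Set ℂ) (Ψ : ℂ → Matrix (Fin m₁) (Fin m₂) ℂ),
    IsOpen U → IsConnected U → (∃ x : ℝ, (x : ℂ) ∈ U) → AnalyticMat Ψ U →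
      (∀ x : ℝ, (x : ℂ) ∈ U → Ψ (x : ℂ) = R x) → ∀ z ∈ U, z.im < 0 → Ψ z = φ z

end

end DiscreteDirac

open DiscreteDirac

/-!
Everything rests on one explicit object, the Darboux matrix
`w_k(z) = I - i z j Π_k^* S_k⁻¹ (I + zA)⁻¹ Π_k`, defined for all `z` in the closed lower half-plane
because the spectrum of `A` lies in the open upper half-plane.

*Algebra.* The identity `A S_k - S_k A^* = i Π_k j Π_k^*` propagates in `k` (`identity_step`) and
gives the intertwining relation `(I + izjC_k) w_k = w_{k+1} (I + izj)` (`darboux_step`) and the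
form identity `w_k^* j w_k = j + 2 Im z · N` with `N ≥ 0` (`transfer_conjTranspose_mul_sig_mul`).
Hence `W_k(z) w_0(z) = w_k(z) (I + izj)^k`, the matrices `w_k` are `j`-unitary on the real axis and
the lower right block of `w_0` is invertible in the closed lower half-plane. Comparing `j`-forms at
`z = 1` gives `C_k j C_k = j`, and `C_k ≥ 0` because `C_k` is a Schur complement of an evidently
nonnegative block matrix (`posSemidef_potential_step`).

*Asymptotics.* The first block column of `Π_k` is `(I + iA⁻¹)^k` times that of `Π_0`, the second one
is `(I - iA⁻¹)^k` times that of `Π_0`. After rescaling by `(I + iA⁻¹)^{-k}` the second column is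
governed by the powers of the Cayley transform of `A`, whose spectrum lies in the unit disc; so it
tends to zero geometrically, while the rescaled `S_k` increase to a positive definite limit
(`tendsto_rescaled_sSeq`). Therefore `w_k(z) → diag(χ(z), I)` and `C_k → I`.

*Conclusion.* For real `z` the matrix `χ` is unitary, and `w_k(z) (I + izj)^k diag(χ^*, I)` is the
Jost solution; its initial value has the same second block column as `w_0(z)`, so that
`R = w₁₂ w₂₂⁻¹` with the blocks of `w_0`. For `Im z < 0` the function `φ = w₁₂ w₂₂⁻¹` makes
`W_k [φ; I]` equal to `(1 - iz)^k` times a convergent sequence, and `|1 - iz|² < 1 + |z|²` makes the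
Weyl series converge. Uniqueness of the Weyl function follows from `C_k ≥ j` and the growth of the
`j`-form of `W_k` (`weylFunction_unique`). Both functions are thus given by the rational function
`w₁₂ w₂₂⁻¹`, and the identity theorem for analytic functions does the rest.
-/

namespace DiscreteDirac

/-! ### The signature matrix -/

theorem sig_mul_sig (m₁ m₂ : ℕ) : sig m₁ m₂ * sig m₁ m₂ = 1 := by
  simp [sig, fromBlocks_multiply, fromBlocks_one]

theorem sig_mul_sig_mul {m₁ m₂ : ℕ} {l : Type*} (X : Matrix (Fin m₁ ⊕ Fin m₂) l ℂ) :
    sig m₁ m₂ * (sig m₁ m₂ * X) = X := by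
  rw [← Matrix.mul_assoc, sig_mul_sig, Matrix.one_mul]

theorem conjTranspose_sig (m₁ m₂ : ℕ) : (sig m₁ m₂)ᴴ = sig m₁ m₂ := by
  simp [sig, fromBlocks_conjTranspose]

/-! ### One step of the recursion -/

section Step

variable {n m₁ m₂ : ℕ} {A S S' : Matrix (Fin n) (Fin n) ℂ}
  {P P' : Matrix (Fin n) (Fin m₁ ⊕ Fin m₂) ℂ}

theorem isUnit_det_conjTranspose (hA : IsUnit A.det) : IsUnit Aᴴ.det := by
  rw [det_conjTranspose]; exact hA.star

/-- The identity `A S - S A^* = i P j P^*` is inherited by the next pair `S'`, `P'`. -/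
theorem identity_step (hA : IsUnit A.det)
    (hS : A * S - S * Aᴴ = Complex.I • (P * sig m₁ m₂ * Pᴴ))
    (hP' : P' = P + Complex.I • (A⁻¹ * P * sig m₁ m₂))
    (hS' : S' = S + A⁻¹ * S * (Aᴴ)⁻¹ + A⁻¹ * (P * Pᴴ) * (Aᴴ)⁻¹) :
    A * S' - S' * Aᴴ = Complex.I • (P' * sig m₁ m₂ * P'ᴴ) := by
  have hA' := isUnit_det_conjTranspose hA
  have h2 := congrArg (fun X => A⁻¹ * X * (Aᴴ)⁻¹) hS
  subst hP' hS'
  simp only [Matrix.mul_add, Matrix.add_mul, Matrix.mul_sub, Matrix.sub_mul, Matrix.smul_mul,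
    Matrix.mul_smul, Matrix.mul_assoc, conjTranspose_add, conjTranspose_smul, conjTranspose_mul,
    conjTranspose_sig, conjTranspose_nonsing_inv, sig_mul_sig_mul, smul_add, smul_smul,
    Complex.star_def, Complex.conj_I, Matrix.mul_nonsing_inv_cancel_left _ _ hA,
    Matrix.nonsing_inv_mul_cancel_left _ _ hA, Matrix.mul_nonsing_inv _ hA',
    Matrix.nonsing_inv_mul _ hA', Matrix.mul_one, mul_neg, neg_mul, Complex.I_mul_I] at hS h2 ⊢
  linear_combination (norm := module) hS + h2

theorem posDef_step (hS : S.PosDef)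
    (hS' : S' = S + A⁻¹ * S * (Aᴴ)⁻¹ + A⁻¹ * (P * Pᴴ) * (Aᴴ)⁻¹) : S'.PosDef := by
  subst hS'
  rw [← conjTranspose_nonsing_inv]
  exact (hS.add_posSemidef (hS.posSemidef.mul_mul_conjTranspose_same _)).add_posSemidef
    ((posSemidef_self_mul_conjTranspose P).mul_mul_conjTranspose_same _)

/-- The function `z ↦ P^* S⁻¹ (I + zA)⁻¹ P`. At `z = 0` it is `P^* S⁻¹ P`, the building block of
the potential. -/
noncomputable def realization (A S : Matrix (Fin n) (Fin n) ℂ)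
    (P : Matrix (Fin n) (Fin m₁ ⊕ Fin m₂) ℂ) (z : ℂ) : BlockMat m₁ m₂ :=
  Pᴴ * S⁻¹ * (1 + z • A)⁻¹ * P

/-- The transfer (Darboux) matrix function `w(z) = I - i z j P^* S⁻¹ (I + zA)⁻¹ P`. In terms of
the spectral parameter `λ = -1/z` it is `I - i j P^* S⁻¹ (A - λ)⁻¹ P`; the form used here is also
meaningful at `z = 0`. -/
noncomputable def transfer (A S : Matrix (Fin n) (Fin n) ℂ)
    (P : Matrix (Fin n) (Fin m₁ ⊕ Fin m₂) ℂ) (z : ℂ) : BlockMat m₁ m₂ :=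
  1 - (Complex.I * z) • (sig m₁ m₂ * realization A S P z)

theorem realization_zero : realization A S P 0 = Pᴴ * S⁻¹ * P := by
  simp [realization]

/-- The Darboux matrix at one value of the index intertwines the system with potential
`C = I + P^* S⁻¹ P - P'^* S'⁻¹ P'` and the trivial system with potential `I`. -/
theorem darboux_step (hA : IsUnit A.det) (hSd : IsUnit S.det) (hSd' : IsUnit S'.det)
    (hS : A * S - S * Aᴴ = Complex.I • (P * sig m₁ m₂ * Pᴴ))
    (hP' : P' = P + Complex.I • (A⁻¹ * P * sig m₁ m₂))
    (hS' : S' = S + A⁻¹ * S * (Aᴴ)⁻¹ + A⁻¹ * (P * Pᴴ) * (Aᴴ)⁻¹)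
    {z : ℂ} (hz : IsUnit (1 + z • A).det) :
    (1 + (Complex.I * z) • (sig m₁ m₂ *
        (1 + Pᴴ * S⁻¹ * P - P'ᴴ * S'⁻¹ * P'))) * transfer A S P z =
      transfer A S' P' z * (1 + (Complex.I * z) • sig m₁ m₂) := by
  have hA' := isUnit_det_conjTranspose hA
  -- the intertwining relation, free of `z`
  have key1 : (A + A⁻¹) * S = S' * Aᴴ + Complex.I • (P' * sig m₁ m₂ * Pᴴ) := by
    subst hP' hS'
    simp only [Matrix.add_mul, Matrix.smul_mul,
      Matrix.mul_assoc, sig_mul_sig_mul, smul_add, smul_smul,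
      Matrix.nonsing_inv_mul _ hA', Matrix.mul_one, Complex.I_mul_I] at hS ⊢
    linear_combination (norm := module) hS
  have hPc : P'ᴴ * Aᴴ = Pᴴ * Aᴴ - Complex.I • (sig m₁ m₂ * Pᴴ) := by
    subst hP'
    simp only [Matrix.add_mul, Matrix.smul_mul,
      Matrix.mul_assoc, conjTranspose_add, conjTranspose_smul, conjTranspose_mul,
      conjTranspose_sig, conjTranspose_nonsing_inv,
      Complex.star_def, Complex.conj_I,
      Matrix.nonsing_inv_mul _ hA', Matrix.mul_one]
    module
  have key2 : P'ᴴ * S'⁻¹ * (A + A⁻¹) = Pᴴ * S⁻¹ * A - Complex.I •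
      ((1 + Pᴴ * S⁻¹ * P - P'ᴴ * S'⁻¹ * P') * sig m₁ m₂ * Pᴴ * S⁻¹) := by
    have h1 := congrArg (fun X => P'ᴴ * S'⁻¹ * X * S⁻¹) key1
    have h2 := congrArg (fun X => X * S⁻¹) hPc
    have h3 := congrArg (fun X => Pᴴ * S⁻¹ * X * S⁻¹) hS
    simp only [Matrix.mul_add, Matrix.add_mul, Matrix.mul_sub, Matrix.sub_mul, Matrix.smul_mul,
      Matrix.mul_smul, Matrix.mul_assoc, Matrix.one_mul, Matrix.mul_one,
      Matrix.mul_nonsing_inv _ hSd, Matrix.nonsing_inv_mul_cancel_left _ _ hSd,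
      Matrix.nonsing_inv_mul_cancel_left _ _ hSd'] at h1 h2 h3 ⊢
    linear_combination (norm := module) h1 + h2 - h3
  set R := (1 + z • A)⁻¹ with hR
  have hRA : R + z • (R * A) = 1 := by
    have := Matrix.nonsing_inv_mul _ hz
    simpa [Matrix.mul_add] using this
  have hAR : R + z • (A * R) = 1 := by
    have := Matrix.mul_nonsing_inv _ hz
    simpa [Matrix.add_mul] using this
  have hAi : R * A⁻¹ = A⁻¹ * R := by
    have h1 := congrArg (fun X => A⁻¹ * X * A⁻¹) (hRA.trans hAR.symm)
    simp only [Matrix.mul_add, Matrix.add_mul, Matrix.smul_mul,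
      Matrix.mul_smul, Matrix.mul_assoc,
      Matrix.nonsing_inv_mul_cancel_left _ _ hA, Matrix.mul_nonsing_inv _ hA, Matrix.mul_one] at h1
    rcases eq_or_ne z 0 with rfl | hz0
    · simp [hR]
    · exact (smul_right_injective _ hz0 (add_left_cancel h1)).symm
  have key3 : P' - R * P' * (1 + (Complex.I * z) • sig m₁ m₂) = z • ((A + A⁻¹) * R * P) := by
    have e1 := congrArg (fun X => X * P) hAR
    have e2 := congrArg (fun X => X * (A⁻¹ * P * sig m₁ m₂)) hRA
    have hAiP := congrArg (fun X => X * P) hAi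
    subst hP'
    simp only [Matrix.mul_add, Matrix.add_mul, Matrix.smul_mul,
      Matrix.mul_smul, Matrix.mul_assoc, Matrix.one_mul, Matrix.mul_one, sig_mul_sig,
      smul_add, smul_smul,
      Matrix.mul_nonsing_inv_cancel_left _ _ hA] at e1 e2 hAiP ⊢
    linear_combination (norm := skip) -e1 - Complex.I • e2 + z • hAiP
    have hI : Complex.I * z * Complex.I = -z := by linear_combination z * Complex.I_mul_I
    simp only [hI]
    module
  have key4 := congrArg (fun X => (Complex.I * z) • (sig m₁ m₂ * (P'ᴴ * S'⁻¹) * X)) key3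
  have key5 := congrArg (fun X => (Complex.I * z * z) • (sig m₁ m₂ * X * (R * P))) key2
  have key6 := congrArg (fun X => (Complex.I * z) • (sig m₁ m₂ * Pᴴ * S⁻¹ * X * P)) hAR
  simp only [transfer, realization, ← hR]
  simp only [Matrix.mul_add, Matrix.add_mul, Matrix.mul_sub, Matrix.sub_mul, Matrix.smul_mul,
      Matrix.mul_smul, Matrix.mul_assoc, Matrix.one_mul, Matrix.mul_one, sig_mul_sig_mul,
      smul_add, smul_sub, smul_smul] at key4 key5 key6 ⊢
  have hI : Complex.I * z * z * Complex.I = Complex.I * z * (Complex.I * z) := by ring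
  simp only [hI] at key4 key5 key6 ⊢
  linear_combination (norm := module) -key4 - key5 - key6

/-- The `j`-form of the Darboux matrix; it is `j`-unitary on the real axis and `j`-contractive
below it. -/
theorem transfer_conjTranspose_mul_sig_mul (hSd : IsUnit S.det) (hSh : S.IsHermitian)
    (hS : A * S - S * Aᴴ = Complex.I • (P * sig m₁ m₂ * Pᴴ))
    {z : ℂ} (hz : IsUnit (1 + z • A).det) :
    (transfer A S P z)ᴴ * sig m₁ m₂ * transfer A S P z = sig m₁ m₂ +
      ((2 * z.im : ℝ) : ℂ) • (((1 + z • A)⁻¹ * P)ᴴ * S⁻¹ * ((1 + z • A)⁻¹ * P)) := by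
  set R := (1 + z • A)⁻¹ with hR
  have hRA : R + z • (A * R) = 1 := by
    have := Matrix.mul_nonsing_inv _ hz
    simpa [Matrix.add_mul] using this
  have hRAc : Rᴴ + star z • (Rᴴ * Aᴴ) = 1 := by
    simpa using congrArg conjTranspose hRA
  have hSi : (S⁻¹)ᴴ = S⁻¹ := by rw [conjTranspose_nonsing_inv, hSh.eq]
  have k1 := congrArg (fun X => (z * star z) • (Pᴴ * Rᴴ * S⁻¹ * X * S⁻¹ * R * P)) hS
  have k2 := congrArg (fun X => (Complex.I * star z) • (Pᴴ * Rᴴ * S⁻¹ * X * P)) hRA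
  have k3 := congrArg (fun X => (Complex.I * z) • (Pᴴ * X * S⁻¹ * R * P)) hRAc
  have him : ((2 * z.im : ℝ) : ℂ) = Complex.I * (star z - z) := by
    apply Complex.ext <;> simp; ring
  rw [him]
  simp only [transfer, realization, ← hR, conjTranspose_sub, conjTranspose_one, conjTranspose_smul,
    conjTranspose_mul, hSi, conjTranspose_conjTranspose, conjTranspose_sig, star_mul',
    Complex.star_def, Complex.conj_I]
  simp only [Complex.star_def, Matrix.mul_add, Matrix.add_mul, Matrix.mul_sub, Matrix.sub_mul,
      Matrix.smul_mul, Matrix.mul_smul, Matrix.mul_assoc, Matrix.one_mul, Matrix.mul_one,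
      sig_mul_sig_mul, sig_mul_sig,
      smul_add, smul_sub, smul_smul, Matrix.mul_nonsing_inv_cancel_left _ _ hSd,
      Matrix.nonsing_inv_mul_cancel_left _ _ hSd] at k1 k2 k3 ⊢
  linear_combination (norm := skip) Complex.I • k1 + k3 - k2
  simp only [smul_smul, smul_sub]
  match_scalars <;> ring

end Step

/-! ### Positivity and `j`-unitarity of the potential -/

theorem conjTranspose_fromCols_mul_mul_fromCols {l p q : Type*} [Fintype l]
    (X : Matrix l p ℂ) (Y : Matrix l q ℂ) (M : Matrix l l ℂ) :
    (fromCols X Y)ᴴ * M * fromCols X Y =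
      fromBlocks (Xᴴ * M * X) (Xᴴ * M * Y) (Yᴴ * M * X) (Yᴴ * M * Y) := by
  rw [conjTranspose_fromCols_eq_fromRows_conjTranspose, fromRows_mul, fromRows_mul_fromCols]

section Step

variable {n m₁ m₂ : ℕ} {A S S' : Matrix (Fin n) (Fin n) ℂ}
  {P P' : Matrix (Fin n) (Fin m₁ ⊕ Fin m₂) ℂ}

/-- The block matrix `[S', P'; P'^*, I + P^* S⁻¹ P]` is a sum of three nonnegative matrices, and
the potential is its Schur complement. -/
theorem posSemidef_potential_step (hS : S.PosDef)
    (hP' : P' = P + Complex.I • (A⁻¹ * P * sig m₁ m₂))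
    (hS' : S' = S + A⁻¹ * S * (Aᴴ)⁻¹ + A⁻¹ * (P * Pᴴ) * (Aᴴ)⁻¹) :
    (1 + Pᴴ * S⁻¹ * P - P'ᴴ * S'⁻¹ * P').PosSemidef := by
  have hSd' : S'.PosDef := posDef_step hS hS'
  have hSd := (isUnit_iff_isUnit_det _).1 hS.isUnit
  have := hSd'.isUnit.invertible
  rw [← Matrix.PosDef.fromBlocks₁₁ P' (1 + Pᴴ * S⁻¹ * P) hSd']
  have h1 := hS.inv.posSemidef.conjTranspose_mul_mul_same (fromCols S P)
  have h2 := PosSemidef.one.conjTranspose_mul_mul_same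
    (fromCols (Pᴴ * (Aᴴ)⁻¹) (Complex.I • sig m₁ m₂))
  have h3 := hS.posSemidef.conjTranspose_mul_mul_same
    (fromCols (Aᴴ)⁻¹ (0 : Matrix (Fin n) (Fin m₁ ⊕ Fin m₂) ℂ))
  have h := (h1.add h2).add h3
  rw [conjTranspose_fromCols_mul_mul_fromCols, conjTranspose_fromCols_mul_mul_fromCols,
    conjTranspose_fromCols_mul_mul_fromCols, fromBlocks_add, fromBlocks_add] at h
  refine (congrArg Matrix.PosSemidef ?_).mpr h
  simp only [hS.isHermitian.eq, conjTranspose_mul, conjTranspose_conjTranspose,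
    conjTranspose_smul, conjTranspose_sig, Matrix.smul_mul, Matrix.mul_smul, sig_mul_sig, smul_smul,
    conjTranspose_nonsing_inv, conjTranspose_zero, Matrix.zero_mul, Matrix.mul_zero, add_zero,
    Matrix.mul_nonsing_inv _ hSd, Matrix.one_mul, Matrix.mul_one,
    Matrix.nonsing_inv_mul_cancel_right _ _ hSd, Complex.star_def, Complex.conj_I, mul_neg,
    Complex.I_mul_I, neg_neg, one_smul]
  congr 1
  · rw [hS']; simp only [Matrix.mul_assoc]; abel
  · rw [hP', Matrix.mul_assoc]
    simp [conjTranspose_sig, Matrix.mul_assoc, conjTranspose_nonsing_inv]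
  · abel

end Step

/-- If the spectrum of `A` lies in the open upper half-plane then `I + zA` is invertible for `z` in
the closed lower half-plane. -/
theorem isUnit_det_one_add_smul {n : ℕ} {A : Matrix (Fin n) (Fin n) ℂ}
    (hA : ∀ μ ∈ spectrum ℂ A, 0 < μ.im) {z : ℂ} (hz : z.im ≤ 0) : IsUnit (1 + z • A).det := by
  rw [← isUnit_iff_isUnit_det]
  rcases eq_or_ne z 0 with rfl | hz0
  · simp
  have h1 : -z⁻¹ ∉ spectrum ℂ A := by
    intro h
    have := hA _ h
    rw [Complex.neg_im, Complex.inv_im, neg_div, neg_neg] at this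
    exact absurd this (not_lt.2 (div_nonpos_of_nonpos_of_nonneg hz (Complex.normSq_nonneg z)))
  rw [spectrum.notMem_iff] at h1
  have h2 : 1 + z • A = (-z) • (algebraMap ℂ (Matrix (Fin n) (Fin n) ℂ) (-z⁻¹) - A) := by
    rw [Algebra.algebraMap_eq_smul_one, smul_sub, smul_smul, neg_mul_neg, mul_inv_cancel₀ hz0]
    module
  rw [h2]
  exact h1.smul (Units.mk0 (-z) (neg_ne_zero.2 hz0))

section Sequences

variable {n m₁ m₂ : ℕ} {A S : Matrix (Fin n) (Fin n) ℂ} {P : Matrix (Fin n) (Fin m₁ ⊕ Fin m₂) ℂ}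

theorem IsAdmissible.sSeq_posDef (h : IsAdmissible A S P) (k : ℕ) : (sSeq A S P k).PosDef := by
  induction k with
  | zero => exact h.posDef
  | succ k ih => exact posDef_step ih rfl

theorem IsAdmissible.isUnit_det_sSeq (h : IsAdmissible A S P) (k : ℕ) :
    IsUnit (sSeq A S P k).det :=
  (isUnit_iff_isUnit_det _).1 (h.sSeq_posDef k).isUnit

theorem IsAdmissible.identity_seq (h : IsAdmissible A S P) (k : ℕ) :
    A * sSeq A S P k - sSeq A S P k * Aᴴ =
      Complex.I • (piSeq A P k * sig m₁ m₂ * (piSeq A P k)ᴴ) := by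
  induction k with
  | zero => exact h.identity
  | succ k ih => exact identity_step h.det_ne_zero.isUnit ih rfl rfl

/-- The Darboux matrix `w_k(z)` of index `k`. -/
noncomputable def darboux (A S : Matrix (Fin n) (Fin n) ℂ)
    (P : Matrix (Fin n) (Fin m₁ ⊕ Fin m₂) ℂ) (k : ℕ) (z : ℂ) : BlockMat m₁ m₂ :=
  transfer A (sSeq A S P k) (piSeq A P k) z

theorem IsStronglyAdmissible.darboux_succ (h : IsStronglyAdmissible A S P) (k : ℕ) {z : ℂ}
    (hz : z.im ≤ 0) :
    (1 + (Complex.I * z) • (sig m₁ m₂ * potential A S P k)) * darboux A S P k z =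
      darboux A S P (k + 1) z * (1 + (Complex.I * z) • sig m₁ m₂) :=
  darboux_step h.det_ne_zero.isUnit (h.isUnit_det_sSeq k) (h.isUnit_det_sSeq (k + 1))
    (h.identity_seq k) rfl rfl (isUnit_det_one_add_smul h.spectrum_upper hz)

/-- The fundamental solution in explicit form. -/
theorem IsStronglyAdmissible.fundSol_mul_darboux (h : IsStronglyAdmissible A S P) (k : ℕ) {z : ℂ}
    (hz : z.im ≤ 0) :
    fundSol (potential A S P) z k * darboux A S P 0 z =
      darboux A S P k z * (1 + (Complex.I * z) • sig m₁ m₂) ^ k := by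
  induction k with
  | zero => simp [fundSol]
  | succ k ih =>
    rw [fundSol, Matrix.mul_assoc, ih, ← Matrix.mul_assoc, h.darboux_succ k hz, pow_succ',
      Matrix.mul_assoc]

theorem IsStronglyAdmissible.darboux_form (h : IsStronglyAdmissible A S P) (k : ℕ) {z : ℂ}
    (hz : z.im ≤ 0) : ∃ N : BlockMat m₁ m₂, N.PosSemidef ∧
    (darboux A S P k z)ᴴ * sig m₁ m₂ * darboux A S P k z =
      sig m₁ m₂ + ((2 * z.im : ℝ) : ℂ) • N :=
  ⟨_, (h.sSeq_posDef k).inv.posSemidef.conjTranspose_mul_mul_same _,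
    transfer_conjTranspose_mul_sig_mul (h.isUnit_det_sSeq k) (h.sSeq_posDef k).isHermitian
      (h.identity_seq k) (isUnit_det_one_add_smul h.spectrum_upper hz)⟩

theorem IsStronglyAdmissible.darboux_sig_unitary (h : IsStronglyAdmissible A S P) (k : ℕ) (x : ℝ) :
    (darboux A S P k x)ᴴ * sig m₁ m₂ * darboux A S P k x = sig m₁ m₂ := by
  obtain ⟨N, -, hN⟩ := h.darboux_form k (z := (x : ℂ)) (by simp)
  simpa using hN

theorem isUnit_of_sig_unitary {M : BlockMat m₁ m₂} (hM : Mᴴ * sig m₁ m₂ * M = sig m₁ m₂) :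
    IsUnit M := by
  refine IsUnit.of_mul_eq_one_right (sig m₁ m₂ * Mᴴ * sig m₁ m₂) ?_
  rw [Matrix.mul_assoc, Matrix.mul_assoc, ← Matrix.mul_assoc Mᴴ, hM, sig_mul_sig]

theorem IsStronglyAdmissible.potential_mul_sig_mul (h : IsStronglyAdmissible A S P) (k : ℕ)
    (hC : (potential A S P k).IsHermitian) :
    potential A S P k * sig m₁ m₂ * potential A S P k = sig m₁ m₂ := by
  -- compare the `j`-forms of both sides of the intertwining relation at the real point `z = 1`
  have h0 := h.darboux_sig_unitary k 1
  have h1 := h.darboux_sig_unitary (k + 1) 1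
  have hd := h.darboux_succ k (z := ((1 : ℝ) : ℂ)) (by simp)
  set C := potential A S P k
  set w := darboux A S P k (1 : ℝ)
  set w' := darboux A S P (k + 1) (1 : ℝ)
  have hw : IsUnit w := isUnit_of_sig_unitary h0
  have e1 : (1 + (Complex.I * ((1 : ℝ) : ℂ)) • sig m₁ m₂)ᴴ * sig m₁ m₂ *
      (1 + (Complex.I * ((1 : ℝ) : ℂ)) • sig m₁ m₂) = (2 : ℂ) • sig m₁ m₂ := by
    simp [conjTranspose_sig, Matrix.add_mul, Matrix.mul_add, sig_mul_sig, smul_smul]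
    module
  have e2 : (1 + (Complex.I * ((1 : ℝ) : ℂ)) • (sig m₁ m₂ * C))ᴴ * sig m₁ m₂ *
      (1 + (Complex.I * ((1 : ℝ) : ℂ)) • (sig m₁ m₂ * C)) =
      sig m₁ m₂ + C * sig m₁ m₂ * C := by
    simp [conjTranspose_sig, Matrix.add_mul, Matrix.mul_add, sig_mul_sig, smul_smul, hC.eq,
      Matrix.mul_assoc, sig_mul_sig_mul]
  have e3 : wᴴ * (sig m₁ m₂ + C * sig m₁ m₂ * C) * w = wᴴ * ((2 : ℂ) • sig m₁ m₂) * w := by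
    calc wᴴ * (sig m₁ m₂ + C * sig m₁ m₂ * C) * w
        = ((1 + (Complex.I * ((1 : ℝ) : ℂ)) • (sig m₁ m₂ * C)) * w)ᴴ * sig m₁ m₂ *
          ((1 + (Complex.I * ((1 : ℝ) : ℂ)) • (sig m₁ m₂ * C)) * w) := by
          rw [← e2, conjTranspose_mul]; simp only [Matrix.mul_assoc]
      _ = (1 + (Complex.I * ((1 : ℝ) : ℂ)) • sig m₁ m₂)ᴴ * (w'ᴴ * sig m₁ m₂ * w') *
          (1 + (Complex.I * ((1 : ℝ) : ℂ)) • sig m₁ m₂) := by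
          rw [hd, conjTranspose_mul]; simp only [Matrix.mul_assoc]
      _ = _ := by
          rw [h1, e1, Matrix.mul_smul, Matrix.smul_mul, h0]
  have e4 := (show IsUnit wᴴ from hw.star).mul_left_cancel (hw.mul_right_cancel e3)
  have e5 : sig m₁ m₂ + C * sig m₁ m₂ * C = sig m₁ m₂ + sig m₁ m₂ := by
    rw [e4, two_smul]
  exact add_left_cancel e5

theorem IsStronglyAdmissible.isDiracPotential (h : IsStronglyAdmissible A S P) :
    IsDiracPotential (potential A S P) := by
  intro k
  have hpos : (potential A S P k).PosSemidef :=
    posSemidef_potential_step (h.sSeq_posDef k) rfl rfl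
  have hu := h.potential_mul_sig_mul k hpos.isHermitian
  refine ⟨hpos.posDef_iff_isUnit.2 (isUnit_of_sig_unitary ?_), hu⟩
  rw [hpos.isHermitian.eq, hu]

/-- In the closed lower half-plane the second block column of a Darboux matrix is `j`-negative;
hence its lower block is invertible. -/
theorem IsStronglyAdmissible.isUnit_darboux_toBlocks₂₂ (h : IsStronglyAdmissible A S P) (k : ℕ)
    {z : ℂ} (hz : z.im ≤ 0) : IsUnit (darboux A S P k z).toBlocks₂₂ := by
  obtain ⟨N, hN, hw⟩ := h.darboux_form k hz
  set w := darboux A S P k z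
  have hN2 : N.toBlocks₂₂.PosSemidef := hN.submatrix Sum.inr
  have e := congrArg toBlocks₂₂ hw
  have e1 : w.toBlocks₂₂ᴴ * w.toBlocks₂₂ =
      1 + (w.toBlocks₁₂ᴴ * w.toBlocks₁₂ + ((-(2 * z.im) : ℝ) : ℂ) • N.toBlocks₂₂) := by
    rw [← fromBlocks_toBlocks w, ← fromBlocks_toBlocks N, sig, fromBlocks_conjTranspose,
      fromBlocks_multiply, fromBlocks_multiply, fromBlocks_smul, fromBlocks_add] at e
    simp only [toBlocks_fromBlocks₂₂, Matrix.mul_one, Matrix.mul_zero, add_zero, zero_add,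
      Matrix.mul_neg, Matrix.neg_mul] at e
    rw [Complex.ofReal_neg]
    linear_combination (norm := module) -e
  have e2 : (w.toBlocks₂₂ᴴ * w.toBlocks₂₂).PosDef := by
    rw [e1]
    refine PosDef.one.add_posSemidef ((posSemidef_conjTranspose_mul_self _).add (hN2.smul ?_))
    exact_mod_cast (by linarith : (0 : ℝ) ≤ -(2 * z.im))
  exact isUnit_of_mul_isUnit_right e2.isUnit

end Sequences

/-! ### Powers of a matrix with spectrum in the unit disc -/

section Powers

open scoped Matrix.Norms.Frobenius ENNReal NNReal

variable {n : ℕ}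

/-- Gelfand's formula in the form of a geometric bound on the powers. -/
theorem exists_eventually_norm_pow_le {U : Matrix (Fin n) (Fin n) ℂ}
    (hU : ∀ μ ∈ spectrum ℂ U, ‖μ‖ < 1) :
    ∃ ρ : ℝ≥0, ρ < 1 ∧ ∀ᶠ k : ℕ in atTop, ‖U ^ k‖₊ ≤ ρ ^ k := by
  have hr : spectralRadius ℂ U < 1 := by
    rcases subsingleton_or_nontrivial (Matrix (Fin n) (Fin n) ℂ) with h | h
    · rw [Subsingleton.elim U 0, spectrum.spectralRadius_zero]; exact one_pos
    · exact_mod_cast spectrum.spectralRadius_lt_of_forall_lt U (r := 1)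
        (fun μ hμ => by exact_mod_cast hU μ hμ)
  obtain ⟨ρ, hρ, hρ1⟩ := ENNReal.lt_iff_exists_nnreal_btwn.1 hr
  refine ⟨ρ, by exact_mod_cast hρ1, ?_⟩
  have ht := (spectrum.pow_nnnorm_pow_one_div_tendsto_nhds_spectralRadius U).eventually_lt_const hρ
  filter_upwards [ht, eventually_gt_atTop 0] with k hk hk0
  have hk0' : (k : ℝ) ≠ 0 := by exact_mod_cast hk0.ne'
  have h1 := ENNReal.rpow_le_rpow hk.le (Nat.cast_nonneg (α := ℝ) k)
  rw [← ENNReal.rpow_mul, one_div_mul_cancel hk0', ENNReal.rpow_one, ENNReal.rpow_natCast] at h1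
  exact_mod_cast h1

theorem tendsto_pow_atTop_nhds_zero_of_spectrum {U : Matrix (Fin n) (Fin n) ℂ}
    (hU : ∀ μ ∈ spectrum ℂ U, ‖μ‖ < 1) : Tendsto (fun k => U ^ k) atTop (𝓝 0) := by
  obtain ⟨ρ, hρ, h⟩ := exists_eventually_norm_pow_le hU
  refine squeeze_zero_norm' (a := fun k => (ρ : ℝ) ^ k) ?_
    (tendsto_pow_atTop_nhds_zero_of_lt_one ρ.2 hρ)
  filter_upwards [h] with k hk
  exact_mod_cast hk

theorem summable_pow_mul_mul_conjTranspose {U : Matrix (Fin n) (Fin n) ℂ}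
    (hU : ∀ μ ∈ spectrum ℂ U, ‖μ‖ < 1) (M : Matrix (Fin n) (Fin n) ℂ) :
    Summable fun k : ℕ => U ^ k * M * (U ^ k)ᴴ := by
  obtain ⟨ρ, hρ, h⟩ := exists_eventually_norm_pow_le hU
  have hs : Summable fun k : ℕ => ‖M‖ * ((ρ : ℝ) * ρ) ^ k :=
    (summable_geometric_of_lt_one (mul_nonneg ρ.2 ρ.2)
      (mul_lt_one_of_nonneg_of_lt_one_left ρ.2 hρ (NNReal.coe_le_coe.2 hρ.le))).mul_left _
  refine Summable.of_norm_bounded_eventually_nat hs ?_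
  filter_upwards [h] with k hk
  have hk' : ‖U ^ k‖ ≤ (ρ : ℝ) ^ k := by exact_mod_cast hk
  calc ‖U ^ k * M * (U ^ k)ᴴ‖ ≤ ‖U ^ k‖ * ‖M‖ * ‖U ^ k‖ := by
        refine (norm_mul_le _ _).trans ?_
        rw [frobenius_norm_conjTranspose]
        gcongr
        exact norm_mul_le _ _
    _ ≤ (ρ : ℝ) ^ k * ‖M‖ * (ρ : ℝ) ^ k := by gcongr
    _ = ‖M‖ * ((ρ : ℝ) * ρ) ^ k := by rw [mul_pow]; ring

end Powers

/-! ### Limits of matrices -/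

theorem tendsto_matrix_mul {ι l m p : Type*} [Fintype m] {f : Filter ι} {X : ι → Matrix l m ℂ}
    {Y : ι → Matrix m p ℂ} {X₀ : Matrix l m ℂ} {Y₀ : Matrix m p ℂ} (hX : Tendsto X f (𝓝 X₀))
    (hY : Tendsto Y f (𝓝 Y₀)) : Tendsto (fun i => X i * Y i) f (𝓝 (X₀ * Y₀)) := by
  refine tendsto_pi_nhds.2 fun a => tendsto_pi_nhds.2 fun b => ?_
  simp only [Matrix.mul_apply]
  exact tendsto_finsetSum _ fun c _ =>
    (tendsto_pi_nhds.1 (tendsto_pi_nhds.1 hX a) c).mul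
      (tendsto_pi_nhds.1 (tendsto_pi_nhds.1 hY c) b)

theorem tendsto_conjTranspose {ι l m : Type*} {f : Filter ι} {X : ι → Matrix l m ℂ}
    {X₀ : Matrix l m ℂ} (hX : Tendsto X f (𝓝 X₀)) : Tendsto (fun i => (X i)ᴴ) f (𝓝 X₀ᴴ) :=
  (continuous_id.matrix_conjTranspose.tendsto X₀).comp hX

theorem tendsto_fromCols {ι l m p : Type*} {f : Filter ι} {X : ι → Matrix l m ℂ}
    {Y : ι → Matrix l p ℂ} {X₀ : Matrix l m ℂ} {Y₀ : Matrix l p ℂ} (hX : Tendsto X f (𝓝 X₀))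
    (hY : Tendsto Y f (𝓝 Y₀)) :
    Tendsto (fun i => fromCols (X i) (Y i)) f (𝓝 (fromCols X₀ Y₀)) := by
  refine tendsto_pi_nhds.2 fun a => tendsto_pi_nhds.2 ?_
  rintro (b | b)
  · exact tendsto_pi_nhds.1 (tendsto_pi_nhds.1 hX a) b
  · exact tendsto_pi_nhds.1 (tendsto_pi_nhds.1 hY a) b

theorem tendsto_inv_of_isUnit {n : ℕ} {ι : Type*} {f : Filter ι}
    {X : ι → Matrix (Fin n) (Fin n) ℂ} {X₀ : Matrix (Fin n) (Fin n) ℂ} (h0 : IsUnit X₀.det)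
    (hX : Tendsto X f (𝓝 X₀)) : Tendsto (fun i => (X i)⁻¹) f (𝓝 X₀⁻¹) := by
  refine Tendsto.comp (continuousAt_matrix_inv X₀ ?_) hX
  rw [Ring.inverse_eq_inv']
  exact continuousAt_inv₀ h0.ne_zero

theorem posSemidef_of_tendsto {ι l : Type*} [Fintype l] {f : Filter ι} [f.NeBot]
    {X : ι → Matrix l l ℂ} {X₀ : Matrix l l ℂ} (hX : Tendsto X f (𝓝 X₀))
    (hp : ∀ i, (X i).PosSemidef) : X₀.PosSemidef := by
  refine PosSemidef.of_dotProduct_mulVec_nonneg ?_ fun x => ?_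
  · exact tendsto_nhds_unique (tendsto_conjTranspose hX)
      (by simpa only [(hp _).isHermitian.eq] using hX)
  · have hc : Continuous fun M : Matrix l l ℂ => star x ⬝ᵥ (M *ᵥ x) := by fun_prop
    exact ge_of_tendsto' ((hc.tendsto X₀).comp hX) fun i => (hp i).dotProduct_mulVec_nonneg x

/-! ### The Cayley transform of `A` -/

theorem commute_nonsing_inv {n : ℕ} {B X : Matrix (Fin n) (Fin n) ℂ} (hB : IsUnit B.det)
    (h : Commute B X) : Commute B⁻¹ X := by
  have h1 : B⁻¹ * (B * X) * B⁻¹ = B⁻¹ * (X * B) * B⁻¹ := by rw [h.eq]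
  rw [Matrix.nonsing_inv_mul_cancel_left _ _ hB, Matrix.mul_assoc, Matrix.mul_assoc,
    Matrix.mul_nonsing_inv _ hB, Matrix.mul_one] at h1
  exact h1.symm

section Cayley

variable {n : ℕ} {A : Matrix (Fin n) (Fin n) ℂ}

theorem isUnit_det_one_add_I_smul_inv (hA : IsUnit A.det) (hs : ∀ μ ∈ spectrum ℂ A, 0 < μ.im) :
    IsUnit (1 + Complex.I • A⁻¹).det := by
  have h1 : -Complex.I ∉ spectrum ℂ A := fun h => by
    have := hs _ h
    norm_num at this
  rw [spectrum.notMem_iff] at h1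
  have h2 : 1 + Complex.I • A⁻¹ =
      -(A⁻¹ * (algebraMap ℂ (Matrix (Fin n) (Fin n) ℂ) (-Complex.I) - A)) := by
    rw [Algebra.algebraMap_eq_smul_one, Matrix.mul_sub, Matrix.nonsing_inv_mul _ hA,
      Matrix.mul_smul, Matrix.mul_one]
    module
  rw [← isUnit_iff_isUnit_det, h2]
  exact ((isUnit_nonsing_inv_iff.2 ((isUnit_iff_isUnit_det _).2 hA)).mul h1).neg

/-- The Cayley transform `(I + iA⁻¹)⁻¹ (I - iA⁻¹) = (A + i)⁻¹ (A - i)` maps the upper half-plane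
into the unit disc. -/
theorem norm_lt_one_of_mem_spectrum_cayley (hA : IsUnit A.det)
    (hs : ∀ μ ∈ spectrum ℂ A, 0 < μ.im) {μ : ℂ}
    (hμ : μ ∈ spectrum ℂ ((1 + Complex.I • A⁻¹)⁻¹ * (1 - Complex.I • A⁻¹))) : ‖μ‖ < 1 := by
  by_contra hn
  rw [not_lt] at hn
  refine hμ ?_
  have hB := isUnit_det_one_add_I_smul_inv hA hs
  have hBu : IsUnit (1 + Complex.I • A⁻¹)⁻¹ :=
    isUnit_nonsing_inv_iff.2 ((isUnit_iff_isUnit_det _).2 hB)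
  have hAu : IsUnit A⁻¹ := isUnit_nonsing_inv_iff.2 ((isUnit_iff_isUnit_det _).2 hA)
  have h1 : algebraMap ℂ (Matrix (Fin n) (Fin n) ℂ) μ -
      (1 + Complex.I • A⁻¹)⁻¹ * (1 - Complex.I • A⁻¹) =
      (1 + Complex.I • A⁻¹)⁻¹ * (A⁻¹ * ((μ - 1) • A + (Complex.I * (μ + 1)) • 1)) := by
    have e1 : A⁻¹ * ((μ - 1) • A + (Complex.I * (μ + 1)) • 1) =
        μ • (1 + Complex.I • A⁻¹) - (1 - Complex.I • A⁻¹) := by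
      rw [Matrix.mul_add, Matrix.mul_smul, Matrix.mul_smul, Matrix.nonsing_inv_mul _ hA,
        Matrix.mul_one]
      module
    rw [e1, Matrix.mul_sub _ (μ • _), Matrix.mul_smul, Matrix.nonsing_inv_mul _ hB,
      Algebra.algebraMap_eq_smul_one]
  rw [spectrum.mem_resolventSet_iff, h1]
  refine hBu.mul (hAu.mul ?_)
  rcases eq_or_ne μ 1 with rfl | hμ1
  · have h2 : (1 - 1 : ℂ) • A + (Complex.I * (1 + 1)) • (1 : Matrix (Fin n) (Fin n) ℂ) =
        algebraMap ℂ _ (Complex.I * (1 + 1)) := by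
      rw [Algebra.algebraMap_eq_smul_one]; simp
    rw [h2]
    exact (IsUnit.mk0 _ (by norm_num)).map _
  · have hμ1' : μ - 1 ≠ 0 := sub_ne_zero.2 hμ1
    have h3 : -(Complex.I * (μ + 1)) / (μ - 1) ∉ spectrum ℂ A := by
      intro h
      have h4 := hs _ h
      have h5 : (-(Complex.I * (μ + 1)) / (μ - 1)).im =
          -(Complex.normSq μ - 1) / Complex.normSq (μ - 1) := by
        rw [Complex.div_im, Complex.normSq_apply μ]
        simp
        ring
      rw [h5, Complex.normSq_eq_norm_sq μ] at h4
      have h6 : -(‖μ‖ ^ 2 - 1) / Complex.normSq (μ - 1) ≤ 0 :=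
        div_nonpos_of_nonpos_of_nonneg (by nlinarith) (Complex.normSq_nonneg _)
      exact absurd h4 (not_lt.2 h6)
    rw [spectrum.notMem_iff] at h3
    have h4 : (μ - 1) • A + (Complex.I * (μ + 1)) • (1 : Matrix (Fin n) (Fin n) ℂ) =
        (-(μ - 1)) • (algebraMap ℂ (Matrix (Fin n) (Fin n) ℂ)
          (-(Complex.I * (μ + 1)) / (μ - 1)) - A) := by
      have h5 : -(μ - 1) * (-(Complex.I * (μ + 1)) / (μ - 1)) = Complex.I * (μ + 1) := by
        field_simp
      rw [Algebra.algebraMap_eq_smul_one, smul_sub, smul_smul, h5]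
      module
    rw [h4]
    exact h3.smul (Units.mk0 _ (neg_ne_zero.2 hμ1'))

end Cayley

/-! ### Limits of the Darboux matrices and of the potential -/

section Asymptotics

variable {n m₁ m₂ : ℕ} {A S : Matrix (Fin n) (Fin n) ℂ} {P : Matrix (Fin n) (Fin m₁ ⊕ Fin m₂) ℂ}

/-- The matrix `I + iA⁻¹`, by which the first block column of `Π_k` is multiplied at each step. -/
noncomputable def plusFactor (A : Matrix (Fin n) (Fin n) ℂ) : Matrix (Fin n) (Fin n) ℂ :=
  1 + Complex.I • A⁻¹

/-- The matrix `I - iA⁻¹`, by which the second block column of `Π_k` is multiplied at each step. -/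
noncomputable def minusFactor (A : Matrix (Fin n) (Fin n) ℂ) : Matrix (Fin n) (Fin n) ℂ :=
  1 - Complex.I • A⁻¹

theorem fromCols_mul_sig (X : Matrix (Fin n) (Fin m₁) ℂ) (Y : Matrix (Fin n) (Fin m₂) ℂ) :
    fromCols X Y * sig m₁ m₂ = fromCols X (-Y) := by
  simp [sig, fromCols_mul_fromBlocks]

theorem piSeq_eq_fromCols (k : ℕ) :
    piSeq A P k = fromCols (plusFactor A ^ k * P.toCols₁) (minusFactor A ^ k * P.toCols₂) := by
  induction k with
  | zero => simp [piSeq]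
  | succ k ih =>
    rw [piSeq, ih, Matrix.mul_assoc, fromCols_mul_sig, mul_fromCols, pow_succ', pow_succ',
      Matrix.mul_assoc, Matrix.mul_assoc]
    ext a (b | b)
    · simp [plusFactor, Matrix.add_mul]
    · simp [minusFactor, Matrix.sub_mul, ← sub_eq_add_neg]

/-- The recursion for `S_k` in the form `S_{k+1} = B S_k B^* + 2 A⁻¹ θ_k θ_k^* (A^*)⁻¹`, where
`B = I + iA⁻¹` and `θ_k` is the second block column of `Π_k`. -/
theorem sSeq_succ_eq (h : IsAdmissible A S P) (k : ℕ) :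
    sSeq A S P (k + 1) = plusFactor A * sSeq A S P k * (plusFactor A)ᴴ +
      (2 : ℂ) • (A⁻¹ * (minusFactor A ^ k * P.toCols₂) *
        (A⁻¹ * (minusFactor A ^ k * P.toCols₂))ᴴ) := by
  have hA := h.det_ne_zero.isUnit
  have hA' := isUnit_det_conjTranspose hA
  have e := congrArg (fun X => A⁻¹ * X * (Aᴴ)⁻¹) (h.identity_seq k)
  rw [sSeq]
  have e2 : piSeq A P k * (piSeq A P k)ᴴ = piSeq A P k * sig m₁ m₂ * (piSeq A P k)ᴴ +
      (2 : ℂ) • ((minusFactor A ^ k * P.toCols₂) * (minusFactor A ^ k * P.toCols₂)ᴴ) := by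
    rw [piSeq_eq_fromCols, fromCols_mul_sig, conjTranspose_fromCols_eq_fromRows_conjTranspose,
      fromCols_mul_fromRows, fromCols_mul_fromRows, Matrix.neg_mul]
    module
  rw [e2, conjTranspose_mul A⁻¹]
  simp only [plusFactor, Matrix.mul_add, Matrix.add_mul, Matrix.mul_sub, Matrix.sub_mul,
    Matrix.smul_mul, Matrix.mul_smul, Matrix.mul_assoc, conjTranspose_add, conjTranspose_one,
    conjTranspose_smul, conjTranspose_nonsing_inv, smul_add, smul_smul, Matrix.one_mul,
    Matrix.mul_one, Complex.star_def, Complex.conj_I, Matrix.nonsing_inv_mul_cancel_left _ _ hA,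
    Matrix.mul_nonsing_inv _ hA', neg_mul, Complex.I_mul_I] at e ⊢
  linear_combination (norm := skip) Complex.I • e
  simp only [smul_sub, smul_smul, Complex.I_mul_I]
  module

/-- Invariance under a change of basis that commutes with `A`. -/
theorem realization_conj {V : Matrix (Fin n) (Fin n) ℂ} (hV : IsUnit V.det) (hVA : Commute V A)
    {z : ℂ} (hz : IsUnit (1 + z • A).det) :
    realization A (V * S * Vᴴ) (V * P) z = realization A S P z := by
  have hV' := isUnit_det_conjTranspose hV
  have hc : Commute (1 + z • A)⁻¹ V :=
    commute_nonsing_inv hz ((Commute.one_left V).add_left (hVA.symm.smul_left z))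
  simp only [realization]
  rw [conjTranspose_mul, Matrix.mul_inv_rev, Matrix.mul_inv_rev, Matrix.mul_assoc _ (1 + z • A)⁻¹,
    ← Matrix.mul_assoc (1 + z • A)⁻¹ V, hc.eq]
  simp only [Matrix.mul_assoc]
  rw [Matrix.mul_nonsing_inv_cancel_left _ _ hV', Matrix.nonsing_inv_mul_cancel_left _ _ hV]

theorem commute_plusFactor_self (hA : IsUnit A.det) : Commute (plusFactor A) A := by
  have h : Commute A⁻¹ A := commute_nonsing_inv hA (Commute.refl A)
  exact (Commute.one_left A).add_left (h.smul_left _)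

theorem commute_plusFactor_minusFactor : Commute (plusFactor A) (minusFactor A) := by
  have h : Commute (Complex.I • A⁻¹) (minusFactor A) :=
    (Commute.one_right _).sub_right (Commute.refl _)
  exact (Commute.one_left _).add_left h

/-- The rescaled matrices `(I + iA⁻¹)^{-k} S_k ((I + iA⁻¹)^{-k})^*` increase and differ by terms of
a convergent series, so they have a positive definite limit. -/
theorem IsStronglyAdmissible.tendsto_rescaled_sSeq (h : IsStronglyAdmissible A S P) :
    ∃ Q : Matrix (Fin n) (Fin n) ℂ, Q.PosDef ∧ Tendsto (fun k =>
      (plusFactor A)⁻¹ ^ k * sSeq A S P k * ((plusFactor A)⁻¹ ^ k)ᴴ) atTop (𝓝 Q) := by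
  have hA := h.det_ne_zero.isUnit
  have hB : IsUnit (plusFactor A).det := isUnit_det_one_add_I_smul_inv hA h.spectrum_upper
  set V := (plusFactor A)⁻¹
  set U := V * minusFactor A with hU
  have hVB : V * plusFactor A = 1 := Matrix.nonsing_inv_mul _ hB
  have hBV : (plusFactor A)ᴴ * Vᴴ = 1 := by rw [← conjTranspose_mul, hVB, conjTranspose_one]
  have hVm : Commute V (minusFactor A) := commute_nonsing_inv hB commute_plusFactor_minusFactor
  have hVA : Commute V A := commute_nonsing_inv hB (commute_plusFactor_self hA)
  have hVAi : Commute V A⁻¹ := (commute_nonsing_inv hA hVA.symm).symm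
  set G := V * A⁻¹
  set M := P.toCols₂ * P.toCols₂ᴴ
  have hM : M.PosSemidef := posSemidef_self_mul_conjTranspose _
  have hUs : ∀ μ ∈ spectrum ℂ U, ‖μ‖ < 1 := fun μ hμ =>
    norm_lt_one_of_mem_spectrum_cayley hA h.spectrum_upper hμ
  have hsum := summable_pow_mul_mul_conjTranspose hUs M
  have hQ : ∀ k, V ^ k * sSeq A S P k * (V ^ k)ᴴ =
      S + (2 : ℂ) • (G * (∑ l ∈ Finset.range k, U ^ l * M * (U ^ l)ᴴ) * Gᴴ) := by
    intro k
    induction k with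
    | zero => simp [sSeq]
    | succ k ih =>
      have e1 : V ^ (k + 1) * (plusFactor A * sSeq A S P k * (plusFactor A)ᴴ) * (V ^ (k + 1))ᴴ =
          V ^ k * sSeq A S P k * (V ^ k)ᴴ := by
        rw [pow_succ, conjTranspose_mul]
        calc _ = V ^ k * (V * plusFactor A) * sSeq A S P k * ((plusFactor A)ᴴ * Vᴴ) *
              (V ^ k)ᴴ := by simp only [Matrix.mul_assoc]
          _ = _ := by rw [hVB, hBV, Matrix.mul_one, Matrix.mul_one]
      have e2 : V ^ (k + 1) * (A⁻¹ * (minusFactor A ^ k * P.toCols₂)) = G * (U ^ k * P.toCols₂) := by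
        rw [hU, hVm.mul_pow, pow_succ']
        simp only [G, Matrix.mul_assoc]
        rw [← Matrix.mul_assoc (V ^ k) A⁻¹, (hVAi.pow_left k).eq]
        simp only [Matrix.mul_assoc]
      have e3 : V ^ (k + 1) * ((A⁻¹ * (minusFactor A ^ k * P.toCols₂)) *
          (A⁻¹ * (minusFactor A ^ k * P.toCols₂))ᴴ) * (V ^ (k + 1))ᴴ =
          G * (U ^ k * M * (U ^ k)ᴴ) * Gᴴ := by
        rw [← Matrix.mul_assoc, e2, Matrix.mul_assoc, ← conjTranspose_mul, e2]
        simp only [M, conjTranspose_mul, Matrix.mul_assoc]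
      rw [sSeq_succ_eq h.toIsAdmissible, Matrix.mul_add, Matrix.add_mul, e1, ih, Matrix.mul_smul,
        Matrix.smul_mul, e3, Finset.sum_range_succ, Matrix.mul_add, Matrix.add_mul, smul_add,
        add_assoc]
  have hlim := hsum.hasSum.tendsto_sum_nat
  set N := ∑' l, U ^ l * M * (U ^ l)ᴴ
  have hN : N.PosSemidef := posSemidef_of_tendsto hlim fun k =>
    posSemidef_sum _ fun l _ => hM.mul_mul_conjTranspose_same _
  refine ⟨S + (2 : ℂ) • (G * N * Gᴴ),
    h.posDef.add_posSemidef ((hN.mul_mul_conjTranspose_same G).smul (by norm_num)), ?_⟩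
  simp only [hQ]
  exact ((tendsto_matrix_mul (tendsto_matrix_mul tendsto_const_nhds hlim)
    tendsto_const_nhds).const_smul _).const_add _

theorem IsStronglyAdmissible.tendsto_rescaled_piSeq (h : IsStronglyAdmissible A S P) :
    Tendsto (fun k => (plusFactor A)⁻¹ ^ k * piSeq A P k) atTop (𝓝 (fromCols P.toCols₁ 0)) := by
  have hA := h.det_ne_zero.isUnit
  have hB : IsUnit (plusFactor A).det := isUnit_det_one_add_I_smul_inv hA h.spectrum_upper
  have hVm : Commute (plusFactor A)⁻¹ (minusFactor A) :=
    commute_nonsing_inv hB commute_plusFactor_minusFactor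
  have hVB : Commute (plusFactor A)⁻¹ (plusFactor A) := commute_nonsing_inv hB (Commute.refl _)
  have e : ∀ k, (plusFactor A)⁻¹ ^ k * piSeq A P k =
      fromCols P.toCols₁ (((plusFactor A)⁻¹ * minusFactor A) ^ k * P.toCols₂) := by
    intro k
    rw [piSeq_eq_fromCols, mul_fromCols, ← Matrix.mul_assoc, ← Matrix.mul_assoc, hVm.mul_pow,
      ← hVB.mul_pow, Matrix.nonsing_inv_mul _ hB, one_pow, Matrix.one_mul]
  simp only [e]
  refine tendsto_fromCols tendsto_const_nhds ?_
  have hU : Tendsto (fun k => ((plusFactor A)⁻¹ * minusFactor A) ^ k) atTop (𝓝 0) :=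
    tendsto_pow_atTop_nhds_zero_of_spectrum fun μ hμ =>
      norm_lt_one_of_mem_spectrum_cayley hA h.spectrum_upper hμ
  simpa only [Matrix.zero_mul] using
    tendsto_matrix_mul hU (tendsto_const_nhds (x := P.toCols₂))

/-- The limit of `Π_k^* S_k⁻¹ (I + zA)⁻¹ Π_k` has only an upper left block. -/
theorem IsStronglyAdmissible.tendsto_realization (h : IsStronglyAdmissible A S P) :
    ∃ X : ℂ → Matrix (Fin m₁) (Fin m₁) ℂ, ∀ z : ℂ, z.im ≤ 0 →
      Tendsto (fun k => realization A (sSeq A S P k) (piSeq A P k) z) atTop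
        (𝓝 (fromBlocks (X z) 0 0 0)) := by
  obtain ⟨Q, hQ, hQt⟩ := h.tendsto_rescaled_sSeq
  have hPt := h.tendsto_rescaled_piSeq
  have hA := h.det_ne_zero.isUnit
  have hB : IsUnit (plusFactor A).det := isUnit_det_one_add_I_smul_inv hA h.spectrum_upper
  have hVA : Commute (plusFactor A)⁻¹ A := commute_nonsing_inv hB (commute_plusFactor_self hA)
  refine ⟨fun z => P.toCols₁ᴴ * (Q⁻¹ * (1 + z • A)⁻¹) * P.toCols₁, fun z hz => ?_⟩
  have e1 : ∀ k, realization A (sSeq A S P k) (piSeq A P k) z =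
      realization A ((plusFactor A)⁻¹ ^ k * sSeq A S P k * ((plusFactor A)⁻¹ ^ k)ᴴ)
        ((plusFactor A)⁻¹ ^ k * piSeq A P k) z := by
    intro k
    refine (realization_conj ?_ (hVA.pow_left k)
      (isUnit_det_one_add_smul h.spectrum_upper hz)).symm
    rw [det_pow]
    exact ((isUnit_nonsing_inv_det_iff).2 hB).pow k
  have hlim : (fromCols P.toCols₁ (0 : Matrix (Fin n) (Fin m₂) ℂ))ᴴ * Q⁻¹ * (1 + z • A)⁻¹ *
      fromCols P.toCols₁ (0 : Matrix (Fin n) (Fin m₂) ℂ) =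
      fromBlocks (P.toCols₁ᴴ * (Q⁻¹ * (1 + z • A)⁻¹) * P.toCols₁) 0 0 0 := by
    rw [Matrix.mul_assoc _ Q⁻¹, conjTranspose_fromCols_mul_mul_fromCols]
    simp
  rw [← hlim]
  refine Tendsto.congr (fun k => (e1 k).symm) ?_
  exact tendsto_matrix_mul (tendsto_matrix_mul (tendsto_matrix_mul (tendsto_conjTranspose hPt)
    (tendsto_inv_of_isUnit ((isUnit_iff_isUnit_det _).1 hQ.isUnit) hQt))
    tendsto_const_nhds) hPt

theorem IsStronglyAdmissible.tendsto_darboux (h : IsStronglyAdmissible A S P) {z : ℂ}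
    (hz : z.im ≤ 0) : ∃ χ : Matrix (Fin m₁) (Fin m₁) ℂ,
      Tendsto (fun k => darboux A S P k z) atTop (𝓝 (fromBlocks χ 0 0 1)) := by
  obtain ⟨X, hX⟩ := h.tendsto_realization
  refine ⟨1 - (Complex.I * z) • X z, ?_⟩
  have := ((tendsto_matrix_mul (tendsto_const_nhds (x := sig m₁ m₂)) (hX z hz)).const_smul
    (Complex.I * z)).const_sub 1
  have e : (1 : BlockMat m₁ m₂) - (Complex.I * z) • (sig m₁ m₂ * fromBlocks (X z) 0 0 0) =
      fromBlocks (1 - (Complex.I * z) • X z) 0 0 1 := by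
    rw [sig, fromBlocks_multiply, fromBlocks_smul, ← fromBlocks_one, sub_eq_add_neg,
      fromBlocks_neg, fromBlocks_add]
    simp [sub_eq_add_neg]
  rw [e] at this
  exact this

theorem IsStronglyAdmissible.tendsto_potential (h : IsStronglyAdmissible A S P) :
    Tendsto (potential A S P) atTop (𝓝 1) := by
  obtain ⟨X, hX⟩ := h.tendsto_realization
  have h0 := hX 0 le_rfl
  have := (h0.const_add 1).sub (h0.comp (tendsto_add_atTop_nat 1))
  rw [add_sub_cancel_right] at this
  refine this.congr fun k => ?_
  simp only [Function.comp, realization_zero, potential]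

/-- At a real point the limit of the Darboux matrices is `j`-unitary, so its block `χ` is
unitary. -/
theorem IsStronglyAdmissible.tendsto_darboux_real (h : IsStronglyAdmissible A S P) (x : ℝ) :
    ∃ χ : Matrix (Fin m₁) (Fin m₁) ℂ, χ * χᴴ = 1 ∧
      Tendsto (fun k => darboux A S P k x) atTop (𝓝 (fromBlocks χ 0 0 1)) := by
  obtain ⟨χ, hχ⟩ := h.tendsto_darboux (z := (x : ℂ)) (by simp)
  refine ⟨χ, ?_, hχ⟩
  have h1 := tendsto_matrix_mul (tendsto_matrix_mul (tendsto_conjTranspose hχ)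
    (tendsto_const_nhds (x := sig m₁ m₂))) hχ
  simp only [h.darboux_sig_unitary] at h1
  have h2 := congrArg toBlocks₁₁ (tendsto_nhds_unique h1 tendsto_const_nhds)
  rw [sig, fromBlocks_conjTranspose, fromBlocks_multiply, fromBlocks_multiply] at h2
  simp only [toBlocks_fromBlocks₁₁] at h2
  rw [mul_eq_one_comm]
  simpa using h2

end Asymptotics

section Jost

variable {n m₁ m₂ : ℕ} {A S : Matrix (Fin n) (Fin n) ℂ} {P : Matrix (Fin n) (Fin m₁ ⊕ Fin m₂) ℂ}

/-! ### Jost solutions -/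

theorem IsSolution.eq_fundSol_mul {C : ℕ → BlockMat m₁ m₂} {z : ℂ} {y : ℕ → BlockMat m₁ m₂}
    (hy : IsSolution C z y) (k : ℕ) : y k = fundSol C z k * y 0 := by
  induction k with
  | zero => simp [fundSol]
  | succ k ih => rw [hy k, ih, fundSol, Matrix.mul_assoc]

theorem one_add_smul_sig_pow (c : ℂ) (k : ℕ) : (1 + c • sig m₁ m₂) ^ k =
    diagonal (Sum.elim (fun _ => (1 + c) ^ k) (fun _ => (1 - c) ^ k)) := by
  have h : 1 + c • sig m₁ m₂ = diagonal (Sum.elim (fun _ => 1 + c) (fun _ => 1 - c)) := by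
    ext (a | a) (b | b)
    · by_cases hab : a = b <;> simp [hab, sig]
    · simp [sig]
    · simp [sig]
    · by_cases hab : a = b <;> simp [hab, sig, sub_eq_add_neg]
  rw [h, diagonal_pow]
  congr 1
  ext (a | a) <;> simp

/-- On the real axis `(I + izj)^k` is a scalar multiple of a unitary diagonal matrix, so that
conjugation by it preserves convergence to the identity. -/
theorem exists_tendsto_zero_conj {M : ℕ → BlockMat m₁ m₂} (hM : Tendsto M atTop (𝓝 1)) (x : ℝ) :
    ∃ E : ℕ → BlockMat m₁ m₂, Tendsto E atTop (𝓝 0) ∧ ∀ k,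
      M k * (1 + (Complex.I * (x : ℂ)) • sig m₁ m₂) ^ k =
        (1 + (Complex.I * (x : ℂ)) • sig m₁ m₂) ^ k * (1 + E k) := by
  set c : ℂ := Complex.I * x with hc
  have hn1 : ‖1 + c‖ = Real.sqrt (1 + x ^ 2) := by
    rw [Complex.norm_def, Complex.normSq_apply]
    congr 1
    simp [hc, pow_two]
  have hn2 : ‖1 - c‖ = Real.sqrt (1 + x ^ 2) := by
    rw [Complex.norm_def, Complex.normSq_apply]
    congr 1
    simp [hc, pow_two]
  set d : ℕ → Fin m₁ ⊕ Fin m₂ → ℂ := fun k =>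
    Sum.elim (fun _ => (1 + c) ^ k) (fun _ => (1 - c) ^ k) with hd
  have hpos : 0 < Real.sqrt (1 + x ^ 2) := Real.sqrt_pos.2 (by positivity)
  have hdn : ∀ k a, ‖d k a‖ = Real.sqrt (1 + x ^ 2) ^ k := by
    rintro k (a | a) <;> simp [hd, hn1, hn2]
  have hd0 : ∀ k a, d k a ≠ 0 := fun k a => by
    rw [← norm_pos_iff, hdn]; positivity
  refine ⟨fun k => diagonal (fun a => (d k a)⁻¹) * (M k - 1) * diagonal (d k), ?_, fun k => ?_⟩
  · refine tendsto_pi_nhds.2 fun a => tendsto_pi_nhds.2 fun b => ?_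
    have h1 : Tendsto (fun k => ‖(M k - 1) a b‖) atTop (𝓝 0) := by
      have h2 := hM.sub_const 1
      rw [sub_self] at h2
      simpa using (tendsto_pi_nhds.1 (tendsto_pi_nhds.1 h2 a) b).norm
    refine squeeze_zero_norm (fun k => le_of_eq ?_) h1
    rw [mul_diagonal, diagonal_mul, norm_mul, norm_mul, norm_inv, hdn, hdn]
    field_simp
  · rw [one_add_smul_sig_pow]
    change M k * diagonal (d k) = diagonal (d k) * (1 + diagonal (fun a => (d k a)⁻¹) *
      (M k - 1) * diagonal (d k))
    ext a b
    rw [Matrix.mul_add, Matrix.mul_one, Matrix.add_apply, diagonal_mul, mul_diagonal,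
      mul_diagonal, diagonal_mul, ← mul_assoc, ← mul_assoc, mul_inv_cancel₀ (hd0 k a), one_mul]
    rcases eq_or_ne a b with rfl | hab
    · simp; ring
    · simp [hab]

/-- Two Jost solutions coincide when the initial value of one of them is invertible. -/
theorem IsJostSolution.eq_of_isUnit {C : ℕ → BlockMat m₁ m₂} {x : ℝ} {F F' : ℕ → BlockMat m₁ m₂}
    (hF : IsJostSolution C x F) (hF' : IsJostSolution C x F') (h0 : IsUnit (F 0)) : F' = F := by
  obtain ⟨hs, E, hE, hFE⟩ := hF
  obtain ⟨hs', E', hE', hFE'⟩ := hF'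
  have hd := (isUnit_iff_isUnit_det _).1 h0
  set X := (F 0)⁻¹ * F' 0 with hX
  have hFX : ∀ k, F' k = F k * X := fun k => by
    rw [hs.eq_fundSol_mul k, hs'.eq_fundSol_mul k, hX, Matrix.mul_assoc,
      Matrix.mul_nonsing_inv_cancel_left _ _ hd]
  have hT : IsUnit (1 + (Complex.I * (x : ℂ)) • sig m₁ m₂) := by
    refine IsUnit.of_mul_eq_one
      (((1 + (x : ℂ) ^ 2)⁻¹) • (1 - (Complex.I * (x : ℂ)) • sig m₁ m₂)) ?_
    have h1 : (1 + (x : ℂ) ^ 2) ≠ 0 := by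
      exact_mod_cast (by positivity : (1 + x ^ 2 : ℝ) ≠ 0)
    have h2 : (1 + (Complex.I * (x : ℂ)) • sig m₁ m₂) * (1 - (Complex.I * (x : ℂ)) • sig m₁ m₂) =
        (1 + (x : ℂ) ^ 2) • 1 := by
      simp only [Matrix.add_mul, Matrix.mul_sub, Matrix.one_mul, Matrix.mul_one, Matrix.smul_mul,
        Matrix.mul_smul, sig_mul_sig, smul_add, smul_smul]
      have h3 : Complex.I * (x : ℂ) * (Complex.I * x) = -(x : ℂ) ^ 2 := by
        linear_combination (x : ℂ) ^ 2 * Complex.I_mul_I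
      rw [h3]
      module
    rw [Matrix.mul_smul, h2, smul_smul, inv_mul_cancel₀ h1, one_smul]
  have hEX : ∀ k, (1 + E k) * X = 1 + E' k := fun k => by
    have h1 := hFX k
    rw [hFE, hFE', Matrix.mul_assoc] at h1
    exact ((hT.pow k).mul_left_cancel h1).symm
  have h1 := tendsto_matrix_mul (hE.const_add 1) (tendsto_const_nhds (x := X))
  simp only [hEX, add_zero, Matrix.one_mul] at h1
  have h2 := tendsto_nhds_unique h1 (hE'.const_add 1)
  ext1 k
  rw [hFX k, h2, add_zero, Matrix.mul_one]

/-- The Jost solution is `w_k(x) (I + ixj)^k diag(χ^*, I)`. The last factor does not affect the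
second block column of the initial value. -/
theorem IsStronglyAdmissible.exists_jostSolution (h : IsStronglyAdmissible A S P) (x : ℝ) :
    ∃ F, IsJostSolution (potential A S P) x F ∧
      (∀ F', IsJostSolution (potential A S P) x F' → F' = F) ∧
      (F 0).toBlocks₁₂ = (transfer A S P x).toBlocks₁₂ ∧
      (F 0).toBlocks₂₂ = (transfer A S P x).toBlocks₂₂ := by
  obtain ⟨χ, hχ, hlim⟩ := h.tendsto_darboux_real x
  -- the inverse of the limit `diag(χ, I)`
  set D : BlockMat m₁ m₂ := fromBlocks χᴴ 0 0 1 with hD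
  have hDs : Commute D (sig m₁ m₂) := by
    simp [Commute, SemiconjBy, hD, sig, fromBlocks_multiply]
  have hDT : Commute D (1 + (Complex.I * (x : ℂ)) • sig m₁ m₂) :=
    (Commute.one_right _).add_right (hDs.smul_right _)
  have hDinv : fromBlocks χ 0 0 1 * D = 1 := by
    rw [hD, fromBlocks_multiply, ← fromBlocks_one]
    simp [hχ]
  have hM := tendsto_matrix_mul hlim (tendsto_const_nhds (x := D))
  rw [hDinv] at hM
  obtain ⟨E, hE, hME⟩ := exists_tendsto_zero_conj hM x
  set F : ℕ → BlockMat m₁ m₂ := fun k =>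
    darboux A S P k x * D * (1 + (Complex.I * (x : ℂ)) • sig m₁ m₂) ^ k with hF
  have hFJ : IsJostSolution (potential A S P) x F := by
    refine ⟨fun k => ?_, E, hE, hME⟩
    simp only [hF]
    rw [← Matrix.mul_assoc, ← Matrix.mul_assoc, h.darboux_succ k (by simp), pow_succ',
      Matrix.mul_assoc _ _ D, ← hDT.eq]
    simp only [Matrix.mul_assoc]
  have hF0 : F 0 = transfer A S P x * D := by simp [hF, darboux, sSeq, piSeq]
  have hu : IsUnit (F 0) := by
    rw [hF0]
    exact (isUnit_of_sig_unitary (h.darboux_sig_unitary 0 x)).mul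
      (IsUnit.of_mul_eq_one_right _ hDinv)
  refine ⟨F, hFJ, fun F' hF' => hFJ.eq_of_isUnit hF' hu, ?_, ?_⟩
  · rw [hF0, ← fromBlocks_toBlocks (transfer A S P x), hD, fromBlocks_multiply]
    simp
  · rw [hF0, ← fromBlocks_toBlocks (transfer A S P x), hD, fromBlocks_multiply]
    simp

/-- The function `w₁₂(z) w₂₂(z)⁻¹` built from the blocks of the Darboux matrix of index `0`: the
common formula for the reflection coefficient and the Weyl function. -/
noncomputable def quotientFunction (A S : Matrix (Fin n) (Fin n) ℂ)
    (P : Matrix (Fin n) (Fin m₁ ⊕ Fin m₂) ℂ) (z : ℂ) : Matrix (Fin m₁) (Fin m₂) ℂ :=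
  (transfer A S P z).toBlocks₁₂ * ((transfer A S P z).toBlocks₂₂)⁻¹

theorem IsStronglyAdmissible.isReflectionCoefficient_iff (h : IsStronglyAdmissible A S P)
    {R : ℝ → Matrix (Fin m₁) (Fin m₂) ℂ} :
    IsReflectionCoefficient (potential A S P) R ↔ ∀ x : ℝ, R x = quotientFunction A S P x := by
  refine forall_congr' fun x => ?_
  obtain ⟨F, hF, huniq, h12, h22⟩ := h.exists_jostSolution x
  constructor
  · rintro ⟨F', hF', -, hR⟩
    rw [hR, huniq F' hF', h12, h22, quotientFunction]
  · intro hR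
    refine ⟨F, hF, ?_, by rw [hR, h12, h22, quotientFunction]⟩
    rw [h22]
    exact h.isUnit_darboux_toBlocks₂₂ 0 (z := (x : ℂ)) (by simp)

/-! ### Weyl functions -/

/-- The column `[0; I_{m₂}]`. -/
noncomputable def lowerCol (m₁ m₂ : ℕ) : Matrix (Fin m₁ ⊕ Fin m₂) (Fin m₂) ℂ := fromRows 0 1

theorem IsStronglyAdmissible.fundSol_mul_weylCol (h : IsStronglyAdmissible A S P) {z : ℂ}
    (hz : z.im ≤ 0) (k : ℕ) :
    fundSol (potential A S P) z k * weylCol (quotientFunction A S P z) =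
      (1 - Complex.I * z) ^ k • (darboux A S P k z * lowerCol m₁ m₂ *
        ((transfer A S P z).toBlocks₂₂)⁻¹) := by
  have hu := (isUnit_iff_isUnit_det _).1 (h.isUnit_darboux_toBlocks₂₂ 0 hz)
  have h1 : weylCol (quotientFunction A S P z) =
      darboux A S P 0 z * (lowerCol m₁ m₂ * ((transfer A S P z).toBlocks₂₂)⁻¹) := by
    have h2 : darboux A S P 0 z * lowerCol m₁ m₂ =
        fromRows (transfer A S P z).toBlocks₁₂ (transfer A S P z).toBlocks₂₂ := by
      rw [← fromBlocks_toBlocks (darboux A S P 0 z), lowerCol, fromBlocks_mul_fromRows]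
      simp [darboux, sSeq, piSeq]
    rw [← Matrix.mul_assoc, h2, fromRows_mul, weylCol, quotientFunction]
    congr 1
    exact (Matrix.mul_nonsing_inv _ hu).symm
  have h2 : (1 + (Complex.I * z) • sig m₁ m₂) ^ k *
      lowerCol m₁ m₂ = (1 - Complex.I * z) ^ k • lowerCol m₁ m₂ := by
    rw [one_add_smul_sig_pow]
    ext (a | a) b <;> rw [diagonal_mul] <;> simp [lowerCol]
  rw [h1, ← Matrix.mul_assoc, h.fundSol_mul_darboux k hz, ← Matrix.mul_assoc,
    Matrix.mul_assoc (darboux A S P k z), h2, Matrix.mul_smul, Matrix.smul_mul]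

/-- The Weyl series is dominated by a geometric series, as `|1 - iz|² < 1 + |z|²` below the real
axis. -/
theorem IsStronglyAdmissible.isWeylFunction (h : IsStronglyAdmissible A S P) :
    IsWeylFunction (potential A S P) (quotientFunction A S P) := by
  intro z hz
  obtain ⟨χ, hχ⟩ := h.tendsto_darboux hz.le
  have hY := tendsto_matrix_mul (tendsto_matrix_mul hχ
    (tendsto_const_nhds (x := lowerCol m₁ m₂)))
    (tendsto_const_nhds (x := ((transfer A S P z).toBlocks₂₂)⁻¹))
  have hB := tendsto_matrix_mul (tendsto_matrix_mul (tendsto_conjTranspose hY)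
    h.tendsto_potential) hY
  set c : ℂ := 1 - Complex.I * z with hc
  set q : ℂ := (((1 + ‖z‖ ^ 2)⁻¹ : ℝ) : ℂ) with hq
  set a : ℂ := q * (star c * c) with ha
  have hterm : ∀ k, q ^ k • ((weylCol (quotientFunction A S P z))ᴴ *
      (fundSol (potential A S P) z k)ᴴ * potential A S P k * fundSol (potential A S P) z k *
      weylCol (quotientFunction A S P z)) =
      a ^ k • ((darboux A S P k z * lowerCol m₁ m₂ * ((transfer A S P z).toBlocks₂₂)⁻¹)ᴴ *
        potential A S P k *
        (darboux A S P k z * lowerCol m₁ m₂ * ((transfer A S P z).toBlocks₂₂)⁻¹)) := by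
    intro k
    rw [← conjTranspose_mul, Matrix.mul_assoc _ (fundSol _ _ _), h.fundSol_mul_weylCol hz.le,
      conjTranspose_smul, Matrix.smul_mul, Matrix.smul_mul, Matrix.mul_smul, smul_smul, smul_smul,
      star_pow, ha, mul_pow, mul_pow, hc]
    congr 1
    ring
  simp only [hterm]
  have hcn : ‖c‖ ^ 2 = 1 + ‖z‖ ^ 2 + 2 * z.im := by
    rw [← Complex.normSq_eq_norm_sq, ← Complex.normSq_eq_norm_sq, Complex.normSq_apply,
      Complex.normSq_apply, hc]
    simp
    ring
  have han : ‖a‖ < 1 := by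
    have hp : 0 < 1 + ‖z‖ ^ 2 := by positivity
    have : ‖a‖ = (1 + ‖z‖ ^ 2)⁻¹ * ‖c‖ ^ 2 := by
      rw [ha, norm_mul, norm_mul, norm_star, hq, Complex.norm_real, Real.norm_eq_abs,
        abs_of_pos (inv_pos.2 hp), pow_two ‖c‖]
    rw [this, inv_mul_lt_one₀ hp, hcn]
    linarith
  refine Pi.summable.2 fun i => Pi.summable.2 fun l => ?_
  have hs : Summable fun k : ℕ => ‖a ^ k‖ := by
    simp only [norm_pow]
    exact summable_geometric_of_lt_one (norm_nonneg _) han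
  have hBil := tendsto_pi_nhds.1 (tendsto_pi_nhds.1 hB i) l
  rw [← Nat.cofinite_eq_atTop] at hBil
  exact Summable.mul_tendsto_const hs hBil

/-- A positive definite `C` with `CjC = j` satisfies `C ≥ j`. -/
theorem IsDiracPotential.posSemidef_sub_sig {C : ℕ → BlockMat m₁ m₂} (hC : IsDiracPotential C)
    (k : ℕ) : (C k - sig m₁ m₂).PosSemidef := by
  obtain ⟨hp, hj⟩ := hC k
  set c := C k
  have hd := (isUnit_iff_isUnit_det _).1 hp.isUnit
  -- `C - j = ½ (C - j) C⁻¹ (C - j)`, because `j C⁻¹ j = C`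
  have h1 : sig m₁ m₂ * c⁻¹ * sig m₁ m₂ = c := by
    have h2 : c * sig m₁ m₂ * c * c⁻¹ * sig m₁ m₂ = sig m₁ m₂ * c⁻¹ * sig m₁ m₂ := by rw [hj]
    rw [← h2, Matrix.mul_nonsing_inv_cancel_right _ _ hd, Matrix.mul_assoc, sig_mul_sig,
      Matrix.mul_one]
  have h2 : (c - sig m₁ m₂)ᴴ * c⁻¹ * (c - sig m₁ m₂) = (2 : ℂ) • (c - sig m₁ m₂) := by
    rw [conjTranspose_sub, conjTranspose_sig, hp.isHermitian.eq, Matrix.sub_mul, Matrix.sub_mul,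
      Matrix.mul_sub, Matrix.mul_sub, h1, Matrix.mul_nonsing_inv _ hd, Matrix.one_mul,
      Matrix.one_mul, Matrix.nonsing_inv_mul_cancel_right _ _ hd]
    module
  have h3 : c - sig m₁ m₂ = (1 / 2 : ℂ) • ((c - sig m₁ m₂)ᴴ * c⁻¹ * (c - sig m₁ m₂)) := by
    rw [h2, smul_smul]
    norm_num
  rw [h3]
  exact (hp.inv.posSemidef.conjTranspose_mul_mul_same _).smul (by
    rw [show (1 / 2 : ℂ) = ((1 / 2 : ℝ) : ℂ) by norm_num]
    exact_mod_cast (by norm_num : (0 : ℝ) ≤ 1 / 2))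

/-- Below the real axis the `j`-form of the fundamental solution grows at least like
`(1 + |z|²)^k`. -/
theorem IsDiracPotential.posSemidef_fundSol_form {C : ℕ → BlockMat m₁ m₂}
    (hC : IsDiracPotential C) {z : ℂ} (hz : z.im ≤ 0) (k : ℕ) :
    ((fundSol C z k)ᴴ * sig m₁ m₂ * fundSol C z k -
      (((1 + ‖z‖ ^ 2 : ℝ) : ℂ) ^ k) • sig m₁ m₂).PosSemidef := by
  induction k with
  | zero => simpa [fundSol] using PosSemidef.zero
  | succ k ih =>
    obtain ⟨hp, hj⟩ := hC k
    set W := fundSol C z k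
    set p : ℂ := ((1 + ‖z‖ ^ 2 : ℝ) : ℂ) with hpdef
    have hstep : (1 + (Complex.I * z) • (sig m₁ m₂ * C k))ᴴ * sig m₁ m₂ *
        (1 + (Complex.I * z) • (sig m₁ m₂ * C k)) =
        p • sig m₁ m₂ + ((-(2 * z.im) : ℝ) : ℂ) • C k := by
      have e1 : star (Complex.I * z) * (Complex.I * z) = p - 1 := by
        rw [hpdef, Complex.star_def, ← Complex.normSq_eq_conj_mul_self, map_mul, Complex.normSq_I,
          one_mul, Complex.normSq_eq_norm_sq]
        push_cast
        ring
      have e2 : ((-(2 * z.im) : ℝ) : ℂ) = star (Complex.I * z) + Complex.I * z := by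
        apply Complex.ext <;> simp
        ring
      rw [e2]
      simp only [conjTranspose_add, conjTranspose_one, conjTranspose_smul, conjTranspose_mul,
        conjTranspose_sig, hp.isHermitian.eq, Matrix.add_mul, Matrix.mul_add, Matrix.smul_mul,
        Matrix.mul_smul, Matrix.one_mul, Matrix.mul_one, sig_mul_sig_mul, smul_add,
        smul_smul, Matrix.mul_assoc, sig_mul_sig] at hj ⊢
      rw [hj, mul_comm (Complex.I * z) (star _), e1]
      module
    have e : (fundSol C z (k + 1))ᴴ * sig m₁ m₂ * fundSol C z (k + 1) - p ^ (k + 1) • sig m₁ m₂ =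
        p • (Wᴴ * sig m₁ m₂ * W - p ^ k • sig m₁ m₂) +
          ((-(2 * z.im) : ℝ) : ℂ) • (Wᴴ * C k * W) := by
      have e3 : (fundSol C z (k + 1))ᴴ * sig m₁ m₂ * fundSol C z (k + 1) =
          Wᴴ * (p • sig m₁ m₂ + ((-(2 * z.im) : ℝ) : ℂ) • C k) * W := by
        rw [fundSol, ← hstep, conjTranspose_mul]
        simp only [W, Matrix.mul_assoc]
      rw [e3]
      simp only [Matrix.mul_add, Matrix.add_mul, Matrix.mul_smul, Matrix.smul_mul, smul_sub,
        smul_smul, pow_succ']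
      module
    rw [e]
    refine (ih.smul ?_).add ((hp.posSemidef.conjTranspose_mul_mul_same W).smul ?_)
    · rw [hpdef]
      exact_mod_cast (by positivity : (0 : ℝ) ≤ 1 + ‖z‖ ^ 2)
    · exact_mod_cast (by linarith : (0 : ℝ) ≤ -(2 * z.im))

/-- The Weyl function is unique. If `φ` and `ψ` differ at `z`, with difference `Δ`, the
parallelogram law bounds `Δ^* Δ` by twice the sum of the `k`-th terms of the two Weyl series. -/
theorem IsDiracPotential.weylFunction_unique {C : ℕ → BlockMat m₁ m₂} (hC : IsDiracPotential C)
    {φ ψ : ℂ → Matrix (Fin m₁) (Fin m₂) ℂ} (hφ : IsWeylFunction C φ) (hψ : IsWeylFunction C ψ)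
    {z : ℂ} (hz : z.im < 0) : φ z = ψ z := by
  set Δ := φ z - ψ z with hΔ
  set p : ℝ := 1 + ‖z‖ ^ 2 with hp
  have hp0 : 0 < p := by positivity
  have ht := (((hφ z hz).tendsto_atTop_zero.add (hψ z hz).tendsto_atTop_zero).const_smul
    (2 : ℂ)).sub_const (Δᴴ * Δ)
  have hpos : (-(Δᴴ * Δ)).PosSemidef := by
    refine posSemidef_of_tendsto
      (by simpa only [add_zero, smul_zero, zero_sub] using ht) fun k => ?_
    set W := fundSol C z k
    obtain ⟨G, hG⟩ : ∃ G, G = weylCol (φ z) - weylCol (ψ z) := ⟨_, rfl⟩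
    have hGΔ : G = fromRows Δ 0 := by
      ext (a | a) b <;> simp [hG, weylCol, hΔ]
    have hj : Gᴴ * sig m₁ m₂ * G = Δᴴ * Δ := by
      rw [hGΔ, conjTranspose_fromRows_eq_fromCols_conjTranspose, sig, fromCols_mul_fromBlocks]
      refine (fromCols_mul_fromRows _ _ _ _).trans ?_
      simp
    have hform : (Wᴴ * C k * W - (p : ℂ) ^ k • sig m₁ m₂).PosSemidef := by
      have e := ((hC.posSemidef_sub_sig k).conjTranspose_mul_mul_same W).add
        (hC.posSemidef_fundSol_form hz.le k)
      rwa [Matrix.mul_sub, Matrix.sub_mul, sub_add_sub_cancel] at e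
    have h1 := hform.conjTranspose_mul_mul_same G
    rw [Matrix.mul_sub, Matrix.sub_mul, Matrix.mul_smul, Matrix.smul_mul, hj] at h1
    have h2 := (hC k).1.posSemidef.conjTranspose_mul_mul_same
      (W * (weylCol (φ z) + weylCol (ψ z)))
    have hq0 : (0 : ℂ) ≤ ((p⁻¹ : ℝ) : ℂ) ^ k := by
      have : (0 : ℝ) ≤ p⁻¹ ^ k := by positivity
      exact_mod_cast this
    have hqp : ((p⁻¹ : ℝ) : ℂ) ^ k * ((p : ℝ) : ℂ) ^ k = 1 := by
      rw [← mul_pow, ← Complex.ofReal_mul, inv_mul_cancel₀ hp0.ne', Complex.ofReal_one, one_pow]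
    have h3 := (h1.add h2).smul hq0
    rw [smul_add, smul_sub, smul_smul, hqp, one_smul, hG] at h3
    refine (congrArg Matrix.PosSemidef ?_).mpr h3
    simp only [Matrix.mul_sub, Matrix.sub_mul, Matrix.mul_add, Matrix.add_mul, conjTranspose_mul,
      conjTranspose_add, conjTranspose_sub, Matrix.mul_assoc, smul_add, smul_sub, ← hp]
    module
  have htr : (Δᴴ * Δ).trace = 0 := by
    refine le_antisymm ?_ (posSemidef_conjTranspose_mul_self Δ).trace_nonneg
    have := hpos.trace_nonneg
    rwa [trace_neg, neg_nonneg] at this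
  exact sub_eq_zero.1 (trace_conjTranspose_mul_self_eq_zero_iff.1 htr)

end Jost

/-! ### Rationality -/

section Rational

open Polynomial

variable {n m₁ m₂ : ℕ} {A S : Matrix (Fin n) (Fin n) ℂ} {P : Matrix (Fin n) (Fin m₁ ⊕ Fin m₂) ℂ}

/-- `transfer`, multiplied by `det (I + zA)`, is a matrix polynomial in `z`. -/
theorem exists_polynomial_transfer (A S : Matrix (Fin n) (Fin n) ℂ)
    (P : Matrix (Fin n) (Fin m₁ ⊕ Fin m₂) ℂ) :
    ∃ N : Matrix (Fin m₁ ⊕ Fin m₂) (Fin m₁ ⊕ Fin m₂) ℂ[X], ∀ z : ℂ, IsUnit (1 + z • A).det →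
      N.map (eval z) = (1 + z • A).det • transfer A S P z := by
  set M : Matrix (Fin n) (Fin n) ℂ[X] := 1 + (X : ℂ[X]) • A.map C
  refine ⟨M.det • 1 - (C Complex.I * X) • ((sig m₁ m₂ * (Pᴴ * S⁻¹)).map C * M.adjugate * P.map C),
    fun z hz => ?_⟩
  have hM : (evalRingHom z).mapMatrix M = 1 + z • A := by
    ext a b
    by_cases hab : a = b <;> simp [M, hab] <;> ring
  have hdet : eval z M.det = (1 + z • A).det := by
    rw [← coe_evalRingHom, RingHom.map_det, hM]
  have hadj : M.adjugate.map (eval z) = (1 + z • A).det • (1 + z • A)⁻¹ := by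
    have h1 := RingHom.map_adjugate (evalRingHom z) M
    rw [hM] at h1
    rw [Matrix.inv_def, smul_smul, Ring.mul_inverse_cancel _ hz, one_smul, ← h1]
    rfl
  have hmul : ((sig m₁ m₂ * (Pᴴ * S⁻¹)).map C * M.adjugate * P.map C).map (eval z) =
      sig m₁ m₂ * (Pᴴ * S⁻¹) * M.adjugate.map (eval z) * P := by
    rw [← coe_evalRingHom, Matrix.map_mul, Matrix.map_mul, Matrix.map_map, Matrix.map_map]
    have hC : (⇑(evalRingHom z) ∘ ⇑(C : ℂ →+* ℂ[X])) = id := by ext c; simp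
    rw [hC, Matrix.map_id, Matrix.map_id]
  have h2 : (M.det • (1 : Matrix (Fin m₁ ⊕ Fin m₂) (Fin m₁ ⊕ Fin m₂) ℂ[X]) - (C Complex.I * X) •
      ((sig m₁ m₂ * (Pᴴ * S⁻¹)).map C * M.adjugate * P.map C)).map (eval z) =
      eval z M.det • 1 - (Complex.I * z) •
      ((sig m₁ m₂ * (Pᴴ * S⁻¹)).map C * M.adjugate * P.map C).map (eval z) := by
    ext a b
    by_cases hab : a = b <;> simp [hab]
  rw [h2, hmul, hadj, hdet, transfer, realization]
  simp only [Matrix.mul_smul, Matrix.smul_mul, smul_sub, Matrix.mul_assoc]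
  rw [smul_comm]

/-- The denominator is `det (I + zA)^{m₂} det w₂₂(z)`, which has no zeros in the closed lower
half-plane. -/
theorem IsStronglyAdmissible.exists_polynomial_quotient (h : IsStronglyAdmissible A S P) :
    ∃ (N : Matrix (Fin m₁) (Fin m₂) ℂ[X]) (q : ℂ[X]), ∀ z : ℂ, z.im ≤ 0 → q.eval z ≠ 0 ∧
      ∀ a b, quotientFunction A S P z a b = (N a b).eval z / q.eval z := by
  obtain ⟨M, hM⟩ := exists_polynomial_transfer A S P
  refine ⟨M.toBlocks₁₂ * M.toBlocks₂₂.adjugate, M.toBlocks₂₂.det, fun z hz => ?_⟩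
  have hu := isUnit_det_one_add_smul h.spectrum_upper hz
  have hw : IsUnit (transfer A S P z).toBlocks₂₂ := h.isUnit_darboux_toBlocks₂₂ 0 hz
  have h1 := hM z hu
  set δ := (1 + z • A).det
  have h12 : M.toBlocks₁₂.map (eval z) = δ • (transfer A S P z).toBlocks₁₂ := congrArg toBlocks₁₂ h1
  have h22 : M.toBlocks₂₂.map (eval z) = δ • (transfer A S P z).toBlocks₂₂ := congrArg toBlocks₂₂ h1
  have hδw : IsUnit (M.toBlocks₂₂.map (eval z)) := by
    rw [h22]; exact hw.smul hu.unit
  have hdet : eval z M.toBlocks₂₂.det = (M.toBlocks₂₂.map (eval z)).det :=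
    RingHom.map_det (evalRingHom z) _
  have hadj : (M.toBlocks₂₂.map (eval z)).adjugate = M.toBlocks₂₂.adjugate.map (eval z) :=
    (RingHom.map_adjugate (evalRingHom z) M.toBlocks₂₂).symm
  have hd := (isUnit_iff_isUnit_det _).1 hδw
  rw [hdet]
  refine ⟨hd.ne_zero, fun a b => ?_⟩
  have h3 : (transfer A S P z).toBlocks₁₂ * ((transfer A S P z).toBlocks₂₂)⁻¹ =
      M.toBlocks₁₂.map (eval z) * (M.toBlocks₂₂.map (eval z))⁻¹ := by
    have hw' : IsUnit (δ • (transfer A S P z).toBlocks₂₂).det := by rw [← h22]; exact hd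
    rw [h12, h22]
    have h4 : ((transfer A S P z).toBlocks₁₂ * ((transfer A S P z).toBlocks₂₂)⁻¹) *
        (δ • (transfer A S P z).toBlocks₂₂) = δ • (transfer A S P z).toBlocks₁₂ := by
      rw [Matrix.mul_smul, Matrix.nonsing_inv_mul_cancel_right _ _
        ((isUnit_iff_isUnit_det _).1 hw)]
    rw [← h4, Matrix.mul_nonsing_inv_cancel_right _ _ hw']
  have h5 : M.toBlocks₁₂.map (eval z) * M.toBlocks₂₂.adjugate.map (eval z) =
      (M.toBlocks₁₂ * M.toBlocks₂₂.adjugate).map (eval z) :=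
    (Matrix.map_mul (f := evalRingHom z)).symm
  rw [quotientFunction, h3, Matrix.inv_def, hadj, Matrix.mul_smul, h5, Ring.inverse_eq_inv']
  simp [div_eq_inv_mul]

/-- A quotient of polynomials, as a rational function, is regular and has the expected value
wherever the given denominator does not vanish. -/
theorem ratFunc_eval_div {p q : ℂ[X]} {z : ℂ} (hq : q.eval z ≠ 0) :
    (algebraMap ℂ[X] (RatFunc ℂ) p / algebraMap ℂ[X] (RatFunc ℂ) q).denom.eval z ≠ 0 ∧
    (algebraMap ℂ[X] (RatFunc ℂ) p / algebraMap ℂ[X] (RatFunc ℂ) q).eval (RingHom.id ℂ) z =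
      p.eval z / q.eval z := by
  have hq0 : algebraMap ℂ[X] (RatFunc ℂ) q ≠ 0 :=
    RatFunc.algebraMap_ne_zero fun h => hq (by simp [h])
  have hd : (algebraMap ℂ[X] (RatFunc ℂ) p / algebraMap ℂ[X] (RatFunc ℂ) q).denom.eval z ≠ 0 :=
    fun h0 => hq (eval_eq_zero_of_dvd_of_eval_eq_zero (RatFunc.denom_div_dvd p q) h0)
  refine ⟨hd, ?_⟩
  have h := RatFunc.eval_mul (RingHom.id ℂ) z
    (x := algebraMap ℂ[X] (RatFunc ℂ) p / algebraMap ℂ[X] (RatFunc ℂ) q)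
    (y := algebraMap ℂ[X] (RatFunc ℂ) q) (by simpa using hd) (by simp)
  rw [div_mul_cancel₀ _ hq0] at h
  simp only [RatFunc.eval_algebraMap, Algebra.algebraMap_self, RingHom.id_apply,
    eval₂_id] at h
  rw [h, mul_div_cancel_right₀ _ hq]

/-! ### Analytic continuation -/

theorem isUniqueAnalyticContinuation_of_rational {N : Matrix (Fin m₁) (Fin m₂) ℂ[X]} {q : ℂ[X]}
    (hq : ∀ z : ℂ, z.im ≤ 0 → q.eval z ≠ 0) {R : ℝ → Matrix (Fin m₁) (Fin m₂) ℂ}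
    {φ : ℂ → Matrix (Fin m₁) (Fin m₂) ℂ}
    (hR : ∀ (x : ℝ) a b, R x a b = (N a b).eval (x : ℂ) / q.eval (x : ℂ))
    (hφ : ∀ z : ℂ, z.im < 0 → ∀ a b, φ z a b = (N a b).eval z / q.eval z) :
    IsUniqueAnalyticContinuation R φ where
  exists_continuation := by
    have hq0 : q ≠ 0 := fun h => hq 0 (by simp) (by simp [h])
    have hset : {z : ℂ | q.eval z ≠ 0} = (q.rootSet ℂ)ᶜ := by
      ext z
      simp [mem_rootSet, hq0]
    refine ⟨{z | q.eval z ≠ 0}, fun z => Matrix.of fun a b => (N a b).eval z / q.eval z, ?_, ?_,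
      fun z hz => hq z hz, ?_, ?_, ?_⟩
    · exact isOpen_ne_fun q.continuous continuous_const
    · rw [hset]
      refine Set.Countable.isConnected_compl_of_one_lt_rank ?_ (q.rootSet_finite ℂ).countable
      rw [Complex.rank_real_complex]
      norm_num
    · intro a b z hz
      exact ((N a b).differentiable.analyticAt z).div (q.differentiable.analyticAt z) hz
    · intro x
      ext a b
      simp [hR]
    · intro z hz
      ext a b
      simp [hφ z hz]
  unique := by
    rintro U Ψ hU hUc ⟨x₀, hx₀⟩ hΨ hΨR z hzU hz
    ext a b
    -- clear the denominator, which may vanish in `U` above the real axis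
    have hf : AnalyticOnNhd ℂ (fun z => q.eval z * Ψ z a b) U := fun w hw =>
      (q.differentiable.analyticAt w).mul (hΨ a b w hw)
    have hg : AnalyticOnNhd ℂ (fun z => (N a b).eval z) U := fun w _ =>
      (N a b).differentiable.analyticAt w
    have hfreq : ∃ᶠ w in 𝓝[≠] (x₀ : ℂ), q.eval w * Ψ w a b = (N a b).eval w := by
      have ht : Tendsto (fun x : ℝ => (x : ℂ)) (𝓝[≠] x₀) (𝓝[≠] (x₀ : ℂ)) :=
        tendsto_nhdsWithin_of_tendsto_nhds_of_eventually_within _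
          (Complex.continuous_ofReal.continuousAt.tendsto.mono_left nhdsWithin_le_nhds)
          (by filter_upwards [self_mem_nhdsWithin] with x hx
              simpa using hx)
      refine ht.frequently (Eventually.frequently ?_)
      have hmem : ∀ᶠ x : ℝ in 𝓝[≠] x₀, (x : ℂ) ∈ U :=
        nhdsWithin_le_nhds (Complex.continuous_ofReal.continuousAt.eventually (hU.mem_nhds hx₀))
      filter_upwards [hmem] with x hx
      rw [hΨR x hx, hR, mul_div_cancel₀ _ (hq x (by simp))]
    have heq := hf.eqOn_of_preconnected_of_frequently_eq hg hUc.isPreconnected hx₀ hfreq hzU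
    rw [hφ z hz, eq_div_iff (hq z hz.le), mul_comm]
    exact heq

end Rational

end DiscreteDirac

theorem theorem3p1 {m₁ m₂ : ℕ} (hm₁ : 0 < m₁) (hm₂ : 0 < m₂)
    (C : ℕ → BlockMat m₁ m₂) (hC : IsStrictlyPseudoExponential C) :
    -- the potential satisfies the standing requirements on a self-adjoint Dirac system
    IsDiracPotential C ∧
    -- the Jost solution, the reflection coefficient and the Weyl function are well defined
    (∀ z : ℝ, ∃! F : ℕ → BlockMat m₁ m₂, IsJostSolution C z F) ∧
    (∃! R : ℝ → Matrix (Fin m₁) (Fin m₂) ℂ, IsReflectionCoefficient C R) ∧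
    (∃ φ : ℂ → Matrix (Fin m₁) (Fin m₂) ℂ, IsWeylFunction C φ) ∧
    (∀ φ ψ : ℂ → Matrix (Fin m₁) (Fin m₂) ℂ, IsWeylFunction C φ → IsWeylFunction C ψ →
      ∀ z : ℂ, z.im < 0 → φ z = ψ z) ∧
    -- they are given by one and the same rational matrix function
    (∃ r : Matrix (Fin m₁) (Fin m₂) (RatFunc ℂ), (∀ z : ℂ, z.im ≤ 0 → RegularAt r z) ∧
      (∀ R : ℝ → Matrix (Fin m₁) (Fin m₂) ℂ, IsReflectionCoefficient C R →
        ∀ x : ℝ, R x = ratEval r (x : ℂ)) ∧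
      (∀ φ : ℂ → Matrix (Fin m₁) (Fin m₂) ℂ, IsWeylFunction C φ →
        ∀ z : ℂ, z.im < 0 → φ z = ratEval r z)) ∧
    -- and the Weyl function is the unique analytic continuation of the reflection coefficient
    (∀ (R : ℝ → Matrix (Fin m₁) (Fin m₂) ℂ) (φ : ℂ → Matrix (Fin m₁) (Fin m₂) ℂ),
      IsReflectionCoefficient C R → IsWeylFunction C φ → IsUniqueAnalyticContinuation R φ) := by
  obtain ⟨n, -, A, S, P, h, hCA⟩ := hC
  obtain rfl : C = potential A S P := funext hCA
  have hD := h.isDiracPotential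
  obtain ⟨N, q, hNq⟩ := h.exists_polynomial_quotient
  have hq : ∀ z : ℂ, z.im ≤ 0 → q.eval z ≠ 0 := fun z hz => (hNq z hz).1
  have hR : ∀ R, IsReflectionCoefficient (potential A S P) R → ∀ (x : ℝ) a b,
      R x a b = (N a b).eval (x : ℂ) / q.eval (x : ℂ) := fun R hR x a b => by
    rw [h.isReflectionCoefficient_iff.1 hR x]
    exact (hNq x (by simp)).2 a b
  have hφ : ∀ φ, IsWeylFunction (potential A S P) φ → ∀ z : ℂ, z.im < 0 → ∀ a b,
      φ z a b = (N a b).eval z / q.eval z := fun φ hφ z hz a b => by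
    rw [hD.weylFunction_unique hφ h.isWeylFunction hz]
    exact (hNq z hz.le).2 a b
  refine ⟨hD, fun x => ?_, ?_, ⟨_, h.isWeylFunction⟩,
    fun φ ψ hφ hψ z hz => hD.weylFunction_unique hφ hψ hz, ?_,
    fun R φ hR' hφ' => isUniqueAnalyticContinuation_of_rational hq (hR R hR') (hφ φ hφ')⟩
  · obtain ⟨F, hF, huniq, -⟩ := h.exists_jostSolution x
    exact ⟨F, hF, huniq⟩
  · exact ⟨fun x => quotientFunction A S P x, h.isReflectionCoefficient_iff.2 fun _ => rfl,
      fun R hR => funext (h.isReflectionCoefficient_iff.1 hR)⟩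
  · refine ⟨Matrix.of fun a b => algebraMap _ _ (N a b) / algebraMap _ _ q,
      fun z hz a b => (ratFunc_eval_div (hq z hz)).1, fun R hR' x => ?_, fun φ hφ' z hz => ?_⟩
    · ext a b
      rw [hR R hR']
      exact (ratFunc_eval_div (hq x (by simp))).2.symm
    · ext a b
      rw [hφ φ hφ' z hz]
      exact (ratFunc_eval_div (hq z hz.le)).2.symm
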